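/- Let $\Delta_{d-1}\subset\mathbb R^d$ be the standard simplex with vertices $w_1,\dots,w_d$. A \emph{fine mixed cell} is a Minkowski sum $B_1+\cdots+B_n$ of nonempty faces of $\Delta_{d-1}$ that lie in independent affine subspaces and whose dimensions add up to $d-1$. A \emph{fine mixed subdivision} $S$ of $n\Delta_{d-1}$ is a subdivision of $n\Delta_{d-1}$ into fine mixed cells such that the intersection of any two cells is a face of both; the nonempty faces of these cells are also called cells of $S$. The cells of $S$ are labelled by ordered Minkowski sums of faces of $\Delta_{d-1}$ in independent affine subspaces, in such a way that if $B_1+\cdots+B_n$ is a face of $C_1+\cdots+C_n$, then $B_i$ is a face of $C_i$ for each $i$. For $a\ne b$ in $[d]$ and $k\in[n]$, there is a unique cell of $S$ with $k-1$ summands equal to $w_b$, $n-k$ summands equal to $w_a$, and one summand equal to the segment $w_aw_b$; let $\sigma_{ab}(k)$ be the index of that last summand. A \emph{system of permutations} on the edges of $n\Delta_{d-1}$ is a collection of permutations $\tau_{ab}$ of $[n]$ ($a\neq b$ in $[d]$) such that $\tau_{ab}$ is the reverse of $\tau_{ba}$. For $i\ne j$ in $[n]$, let $G_{ij}(\tau)$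 be the directed graph on $[d]$ with an arc $a\to b$ ($a\neq b$) if and only if $i$ comes before $j$ in the word $\tau_{ab}(1)\tau_{ab}(2)\cdots\tau_{ab}(n)$. The system $\tau$ is \emph{acyclic} if none of the graphs $G_{ij}(\tau)$ has a directed cycle. \textbf{Theorem.} For every fine mixed subdivision $S$ of $n\Delta_{d-1}$ with such a labelling, $\sigma(S)=(\sigma_{ab})_{a\ne b}$ is a well-defined system of permutations on the edges of $n\Delta_{d-1}$, and it is acyclic. -/

import Mathlib

open scoped Pointwise

namespace FineMixed

/-- The face of the standard simplex `Δ_{d-1} ⊆ ℝ^d` spanned by the vertices `w_a`, `a ∈ A`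
(`w_a` is the `a`-th standard basis vector). For `A` nonempty it is a simplex of dimension
`A.card - 1`. -/
def simplexFace {d : ℕ} (A : Finset (Fin d)) : Set (Fin d → ℝ) :=
  convexHull ℝ ((fun a : Fin d => (Pi.single a 1 : Fin d → ℝ)) '' (A : Set (Fin d)))

/-- The Minkowski sum `B_1 + ⋯ + B_n` of faces of `Δ_{d-1}`; every face is given by its set of
vertices. -/
def minkowskiSum {n d : ℕ} (B : Fin n → Finset (Fin d)) : Set (Fin d → ℝ) :=
  ∑ i, simplexFace (B i)

/-- The summands are (nonempty) faces of `Δ_{d-1}` lying in independent affine subspaces: the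
directions of their affine spans form a direct sum. The dimension is not restricted. -/
def IsFine {n d : ℕ} (B : Fin n → Finset (Fin d)) : Prop :=
  (∀ i, (B i).Nonempty) ∧ iSupIndep (fun i => vectorSpan ℝ (simplexFace (B i)))

/-- `B_1 + ⋯ + B_n` is a fine mixed cell: the `B_i` are faces of `Δ_{d-1}` in independent affine
subspaces, and their dimensions add up to `d - 1`. -/
def IsFineMixedCell {n d : ℕ} (B : Fin n → Finset (Fin d)) : Prop :=
  IsFine B ∧ (∑ i, ((B i).card - 1)) + 1 = d

/-- A fine mixed subdivision of `nΔ_{d-1}`, given by its full-dimensional cells. For a polytope,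
"face" means exposed face; the empty set is a face. -/
structure FineMixedSubdivision (n d : ℕ) where
  /-- the full-dimensional cells -/
  cells : Set (Set (Fin d → ℝ))
  exists_sum : ∀ C ∈ cells, ∃ B : Fin n → Finset (Fin d), IsFineMixedCell B ∧ minkowskiSum B = C
  cover : ⋃₀ cells = (n : ℝ) • stdSimplex ℝ (Fin d)
  inter_face : ∀ C ∈ cells, ∀ D ∈ cells, IsExposed ℝ C (C ∩ D) ∧ IsExposed ℝ D (C ∩ D)

/-- The cells of all dimensions of a subdivision: the nonempty faces of its full-dimensional
cells. -/
def FineMixedSubdivision.faces {n d : ℕ} (S : FineMixedSubdivision n d) :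
    Set (Set (Fin d → ℝ)) :=
  {F | F.Nonempty ∧ ∃ C ∈ S.cells, IsExposed ℝ C F}

/-- A labelling of the cells (of all dimensions) of a subdivision by ordered Minkowski sums, such
that if `B_1 + ⋯ + B_n` is a face of `C_1 + ⋯ + C_n` then `B_i` is a face of `C_i` for each `i`.
It fixes which summand of a cell is the `i`-th one (the numbering of the colours); the
permutations on the edges are read off from it. -/
structure FineMixedSubdivision.Labelling {n d : ℕ} (S : FineMixedSubdivision n d) where
  /-- the ordered summands of a cell; irrelevant outside `S.faces` -/
  label : Set (Fin d → ℝ) → Fin n → Finset (Fin d)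
  isFine : ∀ F ∈ S.faces, IsFine (label F)
  sum_eq : ∀ F ∈ S.faces, minkowskiSum (label F) = F
  mono : ∀ F ∈ S.faces, ∀ G ∈ S.faces, IsExposed ℝ G F → ∀ i, label F i ⊆ label G i

/-- A system of permutations on the edges of `nΔ_{d-1}`: a permutation `σ_{ab}` of `[n]` for all
`a ≠ b` in `[d]`, such that `σ_{ab}` is the reverse of `σ_{ba}`. In one-line notation `σ_{ab}` is
the word `σ_{ab}(1) σ_{ab}(2) … σ_{ab}(n)`. -/
structure SystemOfPermutations (n d : ℕ) where
  /-- the permutation `σ_{ab}` -/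
  perm : ∀ a b : Fin d, a ≠ b → Equiv.Perm (Fin n)
  reverse : ∀ (a b : Fin d) (h : a ≠ b) (k : Fin n), perm b a h.symm k = perm a b h k.rev

/-- In the sum `B_1 + ⋯ + B_n`, exactly `k` summands are `w_b`, exactly `n - 1 - k` summands are
`w_a`, and the remaining summand is the `m`-th one and equals the segment `w_a w_b`. -/
def IsEdgeCell {n d : ℕ} (a b : Fin d) (k : ℕ) (m : Fin n) (B : Fin n → Finset (Fin d)) : Prop :=
  (Finset.univ.filter fun i => B i = {b}).card = k ∧
  (Finset.univ.filter fun i => B i = {a}).card + k + 1 = n ∧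
  B m = {a, b}

/-- `σ` is the system of permutations of the labelled subdivision: for every edge `nw_aw_b` and
every position `k` (counted from `0`), there is a unique cell of the subdivision with `k` summands
`w_b`, `n - 1 - k` summands `w_a` and one summand `w_aw_b`, and the summand `w_aw_b` of this cell
is the one with index `σ_{ab}(k)`. -/
def FineMixedSubdivision.Labelling.IsSystem {n d : ℕ} {S : FineMixedSubdivision n d}
    (L : S.Labelling) (σ : SystemOfPermutations n d) : Prop :=
  ∀ (a b : Fin d) (h : a ≠ b) (k : Fin n),
    ∃ F ∈ S.faces, IsEdgeCell a b k (σ.perm a b h k) (L.label F) ∧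
      ∀ G ∈ S.faces, ∀ m : Fin n, IsEdgeCell a b k m (L.label G) → G = F

/-- The directed graph `G_{ij}(σ)` on `[d]`: for `a ≠ b` there is an arc from `a` to `b` if and only
if `i` comes before `j` in the word `σ_{ab}`. -/
def SystemOfPermutations.arc {n d : ℕ} (σ : SystemOfPermutations n d) (i j : Fin n)
    (a b : Fin d) : Prop :=
  ∃ h : a ≠ b, (σ.perm a b h).symm i < (σ.perm a b h).symm j

/-- A system of permutations is acyclic if no directed graph `G_{ij}(σ)`, `i ≠ j`, has a
directed closed walk of positive length. -/
def SystemOfPermutations.Acyclic {n d : ℕ} (σ : SystemOfPermutations n d) : Prop :=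
  ∀ i j : Fin n, i ≠ j → ∀ a : Fin d, ¬ Relation.TransGen (σ.arc i j) a a

end FineMixed

namespace FineMixed

/-! ### Lipschitz bounds glued along finite closed covers -/

section Gluing

open Set Topology Filter
open scoped NNReal

/-! Consistent labels make every point of `nΔ` a sum of rows `M_1 + ⋯ + M_n` in exactly one way,
with each `M_m` in the `m`-th summand of a common cell (`IsDecomposition.eq`). On the edge
`nw_aw_b`, at the point with `w_b`-weight `k + 1/2`, some row is strictly between `w_a` and `w_b` by
half-integrality, and only one is, since independent summands cannot share two vertices. That row is
the `k`-th letter. Consecutive edge cells meet in a vertex, so the sets of rows already moved to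
`w_b` form a chain, and the letters form a permutation.

Acyclicity needs global information, obtained by a deformation. Scaling turns the decompositions
into a finite union of cones of matrices, which the sum of all rows maps bijectively onto the
orthant. Weight the rows in a set `I` by `1 + c`. The inverse is Lipschitz with a constant
independent of `I` and `c`, so bijectivity propagates from `c` to `c + δ` with a fixed `δ`, hence to
arbitrarily large `c`. As `c → ∞` only the partial sum over `I` matters. It follows that every point
of `|I|Δ` is a partial sum, and that an entry takes all intermediate values between two matrices
with the same partial sum.

For `I = {i}`, the barycentre of a face `A` gives a cell whose `i`-th summand contains `A` and all
of whose summands meet `A`. For `I = {i, j}`, rows `(i, j)` cannot be `(w_b, w_a)` at one vertex and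
`(w_a, w_b)` at another: in between, both rows would contain both vertices. If `G_ij` had a cycle,
let `A` be a strongly connected component with a cycle, take the cell for `A`, a vertex `x ∈ A` of
its `j`-th summand and an arc `q → x` inside `A`. The cell has a vertex with rows `(w_q, w_x)` and
the arc provides one with `(w_x, w_q)`, which is a forbidden exchange. -/

theorem norm_sub_le_of_finite_closed_cover {ι F : Type*} [Finite ι] [NormedAddCommGroup F]
    {g : ℝ → F} {C : ℝ} (hC : 0 ≤ C) {A : ι → Set ℝ} (hA : ∀ i, IsClosed (A i))
    (hcov : Icc (0 : ℝ) 1 ⊆ ⋃ i, A i)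
    (hg : ∀ i, ∀ s ∈ A i ∩ Icc 0 1, ∀ t ∈ A i ∩ Icc 0 1, ‖g s - g t‖ ≤ C * |s - t|) :
    ‖g 1 - g 0‖ ≤ C := by
  have hcont : ContinuousOn g (Icc 0 1) := by
    have h1 : ContinuousOn g (⋃ i, A i ∩ Icc 0 1) := by
      refine (locallyFinite_of_finite _).continuousOn_iUnion
        (fun i => (hA i).inter isClosed_Icc) fun i => ?_
      refine (LipschitzOnWith.of_dist_le_mul (K := ⟨C, hC⟩) fun s hs t ht => ?_).continuousOn
      rw [dist_eq_norm, Real.dist_eq]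
      exact hg i s hs t ht
    refine h1.mono fun t ht => ?_
    obtain ⟨i, hi⟩ := mem_iUnion.1 (hcov ht)
    exact mem_iUnion.2 ⟨i, hi, ht⟩
  have hsub : Icc (0 : ℝ) 1 ⊆ {t | ‖g t - g 0‖ ≤ C * t} := by
    refine IsClosed.Icc_subset_of_forall_exists_gt ?_ (by simp) ?_
    · have := isClosed_Icc.isClosed_le
        (hcont.sub continuousOn_const : ContinuousOn (fun t => g t - g 0) (Icc 0 1)).norm
        (continuousOn_const.mul continuousOn_id : ContinuousOn (fun t : ℝ => C * t) (Icc 0 1))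
      convert this using 1
      ext t
      simp [and_comm]
    · rintro x ⟨hx, hx01⟩ y hy
      -- Finitely many closed pieces: those that miss `x` miss a neighbourhood of it, so any nearby
      -- `z > x` shares a piece with `x`.
      have hU : ∀ᶠ z in 𝓝[>] x, ∀ i, z ∈ A i → x ∈ A i := by
        rw [eventually_all]
        intro i
        by_cases hi : x ∈ A i
        · exact Eventually.of_forall fun _ _ => hi
        · filter_upwards [nhdsWithin_le_nhds ((hA i).isOpen_compl.mem_nhds hi)] with z hz hz'
          exact absurd hz' hz
      have hI : ∀ᶠ z in 𝓝[>] x, z ∈ Ioc x (min y 1) :=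
        Ioc_mem_nhdsGT (lt_min hy hx01.2)
      obtain ⟨z, hzU, hxz, hzy⟩ := (hU.and hI).exists
      have hz1 : z ≤ 1 := hzy.trans (min_le_right _ _)
      have hz01 : z ∈ Icc (0 : ℝ) 1 := ⟨hx01.1.trans hxz.le, hz1⟩
      obtain ⟨i, hi⟩ := mem_iUnion.1 (hcov hz01)
      refine ⟨z, ?_, hxz, hzy.trans (min_le_left _ _)⟩
      have h1 := hg i z ⟨hi, hz01⟩ x ⟨hzU i hi, hx01.1, hx01.2.le⟩
      rw [abs_of_pos (sub_pos.2 hxz)] at h1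
      calc ‖g z - g 0‖ ≤ ‖g z - g x‖ + ‖g x - g 0‖ := norm_sub_le_norm_sub_add_norm_sub _ _ _
        _ ≤ C * (z - x) + C * x := add_le_add h1 hx
        _ = C * z := by ring
  simpa using hsub (right_mem_Icc.2 zero_le_one)

theorem norm_sub_le_of_convex_of_closed_cover {ι E F : Type*} [Finite ι] [NormedAddCommGroup E]
    [NormedSpace ℝ E] [NormedAddCommGroup F] {f : E → F} {K : ℝ} (hK : 0 ≤ K) {X : Set E}
    (hX : Convex ℝ X) {Z : ι → Set E} (hZ : ∀ i, IsClosed (Z i)) (hcov : X ⊆ ⋃ i, Z i)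
    (hf : ∀ i, ∀ x ∈ Z i, ∀ y ∈ Z i, ‖f x - f y‖ ≤ K * ‖x - y‖) {x y : E}
    (hx : x ∈ X) (hy : y ∈ X) : ‖f x - f y‖ ≤ K * ‖x - y‖ := by
  have hγ : Continuous fun t : ℝ => AffineMap.lineMap y x t := AffineMap.lineMap_continuous
  have := norm_sub_le_of_finite_closed_cover (g := fun t : ℝ => f (AffineMap.lineMap y x t))
    (C := K * ‖x - y‖) (by positivity)
    (A := fun i => (fun t : ℝ => AffineMap.lineMap y x t) ⁻¹' Z i)
    (fun i => (hZ i).preimage hγ) (fun t ht => ?_) (fun i s hs t ht => ?_)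
  · simpa using this
  · obtain ⟨i, hi⟩ := mem_iUnion.1 (hcov (hX.lineMap_mem hy hx ht))
    exact mem_iUnion.2 ⟨i, hi⟩
  · refine (hf i _ hs.1 _ ht.1).trans_eq ?_
    rw [mul_assoc]
    congr 1
    rw [← dist_eq_norm, dist_lineMap_lineMap, Real.dist_eq, dist_comm, dist_eq_norm, mul_comm]

end Gluing

/-! ### Cones of matrices and a uniform inverse estimate -/

/-- Matrices supported in `B` are determined by their row and column sums. -/
def SumsInjective {n d : ℕ} (B : Fin n → Finset (Fin d)) : Prop :=
  ∀ N : Fin n → Fin d → ℝ, (∀ m, ∀ a ∉ B m, N m a = 0) → (∀ m, ∑ a, N m a = 0) →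
    ∑ m, N m = 0 → N = 0

/-- The nonnegative matrices supported in `B` all of whose rows have the same sum. -/
def matrixCone {n d : ℕ} (B : Fin n → Finset (Fin d)) : Set (Fin n → Fin d → ℝ) :=
  {N | (∀ m a, 0 ≤ N m a) ∧ (∀ m, ∀ a ∉ B m, N m a = 0) ∧
    ∀ m m', ∑ a, N m a = ∑ a, N m' a}

/-- The sum of the rows, those in `I` being weighted by `1 + c`. -/
def weightedSum {n d : ℕ} (I : Finset (Fin n)) (c : ℝ) (N : Fin n → Fin d → ℝ) : Fin d → ℝ :=
  ∑ m, N m + c • ∑ m ∈ I, N m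

section Cones

variable {n d : ℕ}

theorem weightedSum_sub (I : Finset (Fin n)) (c : ℝ) (N N' : Fin n → Fin d → ℝ) :
    weightedSum I c (N - N') = weightedSum I c N - weightedSum I c N' := by
  simp only [weightedSum, Pi.sub_apply, Finset.sum_sub_distrib, smul_sub]
  abel

theorem weightedSum_eq (I : Finset (Fin n)) (c : ℝ) (N : Fin n → Fin d → ℝ) :
    weightedSum I c N = ∑ m, (1 + if m ∈ I then c else 0) • N m := by
  simp only [weightedSum, add_smul, one_smul, Finset.sum_add_distrib, ite_smul, zero_smul,
    Finset.sum_ite_mem, Finset.univ_inter, Finset.smul_sum]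

theorem weightedSum_apply (I : Finset (Fin n)) (c : ℝ) (N : Fin n → Fin d → ℝ) (a : Fin d) :
    weightedSum I c N a = ∑ m, N m a + c * ∑ m ∈ I, N m a := by
  simp [weightedSum, Finset.sum_apply]

theorem isClosed_matrixCone (B : Fin n → Finset (Fin d)) : IsClosed (matrixCone B) := by
  simp only [matrixCone, Set.ofPred_and, Set.ofPred_forall]
  refine IsClosed.inter ?_ (IsClosed.inter ?_ ?_)
  · exact isClosed_iInter fun m => isClosed_iInter fun a =>
      isClosed_le (by fun_prop) (by fun_prop)
  · exact isClosed_iInter fun m => isClosed_iInter fun a => isClosed_iInter fun _ =>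
      isClosed_eq (by fun_prop) (by fun_prop)
  · exact isClosed_iInter fun m => isClosed_iInter fun a =>
      isClosed_eq (by fun_prop) (by fun_prop)

/-- Row sums, column sums and the entries outside of `B` of a matrix. -/
def sumsAndOutside (B : Fin n → Finset (Fin d)) :
    (Fin n → Fin d → ℝ) →ₗ[ℝ] (Fin n → ℝ) × (Fin d → ℝ) × (Fin n → Fin d → ℝ) where
  toFun N := (fun m => ∑ a, N m a, ∑ m, N m, fun m a => if a ∈ B m then 0 else N m a)
  map_add' N N' := by
    refine Prod.ext ?_ (Prod.ext ?_ ?_)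
    · ext m; simp [Finset.sum_add_distrib]
    · ext m; simp [Finset.sum_add_distrib]
    · ext m a
      by_cases h : a ∈ B m <;> simp [h]
  map_smul' c N := by
    refine Prod.ext ?_ (Prod.ext ?_ ?_)
    · ext m; simp [Finset.mul_sum]
    · ext m; simp [Finset.mul_sum]
    · ext m a
      by_cases h : a ∈ B m <;> simp [h]

theorem SumsInjective.ker_eq_bot {B : Fin n → Finset (Fin d)} (hB : SumsInjective B) :
    LinearMap.ker (sumsAndOutside B) = ⊥ := by
  rw [LinearMap.ker_eq_bot']
  intro N hN
  simp only [sumsAndOutside, LinearMap.coe_mk, AddHom.coe_mk, Prod.mk_eq_zero] at hN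
  refine hB N (fun m a ha => ?_) (fun m => congrFun hN.1 m) hN.2.1
  simpa [ha] using congrFun (congrFun hN.2.2 m) a

/-- The constant must not depend on `I` or `c`. Rescale row `m` by its weight `α m ≥ 1`: the column
sums become `weightedSum I c N`, which also bounds the new row sums because the original ones are
equal and each `α m` is at most the sum of the weights. The fixed injective map `sumsAndOutside B`
then bounds the rescaled matrix, whose norm is at least that of `N`. -/
theorem SumsInjective.exists_norm_le {B : Fin n → Finset (Fin d)} (hB : SumsInjective B) :
    ∃ K : ℝ, 0 ≤ K ∧ ∀ (I : Finset (Fin n)) (c : ℝ), 0 ≤ c → ∀ N : Fin n → Fin d → ℝ,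
      (∀ m, ∀ a ∉ B m, N m a = 0) → (∀ m m', ∑ a, N m a = ∑ a, N m' a) →
        ‖N‖ ≤ K * ‖weightedSum I c N‖ := by
  obtain ⟨K, -, hK⟩ := (sumsAndOutside B).exists_antilipschitzWith hB.ker_eq_bot
  refine ⟨K * (d + 1), by positivity, fun I c hc N hN hrow => ?_⟩
  set α : Fin n → ℝ := fun m => 1 + if m ∈ I then c else 0 with hα
  have hα1 : ∀ m, 1 ≤ α m := fun m => by
    simp only [hα]; split_ifs <;> linarith
  set w := weightedSum I c N with hw
  have hwα : w = ∑ m, α m • N m := weightedSum_eq I c N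
  have hbound := hK.le_mul_dist (fun m => α m • N m) 0
  rw [map_zero, dist_zero_right, dist_zero_right] at hbound
  have hsum : ∀ m, |α m * ∑ a, N m a| ≤ d * ‖w‖ := by
    intro m
    have h1 : ∑ a, w a = (∑ m', α m') * ∑ a, N m a := by
      rw [hwα]
      simp only [Finset.sum_apply, Pi.smul_apply, smul_eq_mul]
      rw [Finset.sum_comm, Finset.sum_mul]
      exact Finset.sum_congr rfl fun m' _ => by rw [← Finset.mul_sum, hrow m' m]
    have h2 : |∑ a, w a| ≤ d * ‖w‖ := by
      refine (Finset.abs_sum_le_sum_abs _ _).trans ?_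
      refine (Finset.sum_le_sum fun a _ => norm_le_pi_norm w a).trans ?_
      simp
    refine le_trans ?_ h2
    rw [h1, abs_mul, abs_mul]
    refine mul_le_mul_of_nonneg_right ?_ (abs_nonneg _)
    rw [abs_of_nonneg (by linarith [hα1 m])]
    refine le_trans ?_ (le_abs_self _)
    exact Finset.single_le_sum (f := α) (fun m' _ => by linarith [hα1 m']) (Finset.mem_univ m)
  have hT : ‖sumsAndOutside B (fun m => α m • N m)‖ ≤ (d + 1) * ‖w‖ := by
    have hw0 := norm_nonneg w
    have hd : (0 : ℝ) ≤ d := by positivity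
    rw [Prod.norm_def, Prod.norm_def]
    refine max_le ?_ (max_le ?_ ?_)
    · refine (pi_norm_le_iff_of_nonneg (by positivity)).2 fun m => ?_
      have : (sumsAndOutside B (fun m => α m • N m)).1 m = α m * ∑ a, N m a := by
        simp [sumsAndOutside, Finset.mul_sum]
      rw [this, Real.norm_eq_abs]
      linarith [hsum m]
    · have : (sumsAndOutside B (fun m => α m • N m)).2.1 = w := by
        rw [hwα]; simp [sumsAndOutside]
      rw [this]
      nlinarith
    · have : (sumsAndOutside B (fun m => α m • N m)).2.2 = 0 := by
        ext m a
        by_cases h : a ∈ B m <;> simp [sumsAndOutside, h, hN m a]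
      rw [this, norm_zero]
      positivity
  calc ‖N‖ ≤ ‖fun m => α m • N m‖ := by
        refine (pi_norm_le_iff_of_nonneg (norm_nonneg _)).2 fun m => ?_
        refine le_trans ?_ (norm_le_pi_norm _ m)
        rw [norm_smul, Real.norm_eq_abs]
        exact le_mul_of_one_le_left (norm_nonneg _) ((hα1 m).trans (le_abs_self _))
    _ ≤ K * ((d + 1) * ‖w‖) := hbound.trans (by gcongr)
    _ = K * (d + 1) * ‖w‖ := by ring

theorem exists_uniform_norm_le (𝓑 : Set (Fin n → Finset (Fin d)))
    (hB : ∀ B ∈ 𝓑, SumsInjective B) :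
    ∃ K : ℝ, 0 ≤ K ∧ ∀ B ∈ 𝓑, ∀ (I : Finset (Fin n)) (c : ℝ), 0 ≤ c →
      ∀ N ∈ matrixCone B, ∀ N' ∈ matrixCone B,
        ‖N - N'‖ ≤ K * ‖weightedSum I c N - weightedSum I c N'‖ := by
  choose! K hK0 hK using fun B hb => (hB B hb).exists_norm_le
  classical
  refine ⟨∑ B, |K B|, Finset.sum_nonneg fun _ _ => abs_nonneg _,
    fun B hb I c hc N hN N' hN' => ?_⟩
  rw [← weightedSum_sub]
  refine (hK B hb I c hc (N - N') (fun m a ha => ?_) (fun m m' => ?_)).trans ?_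
  · simp [hN.2.1 m a ha, hN'.2.1 m a ha]
  · simp [hN.2.2 m m', hN'.2.2 m m']
  · refine mul_le_mul_of_nonneg_right ((le_abs_self _).trans ?_) (norm_nonneg _)
    exact Finset.single_le_sum (f := fun B => |K B|) (fun _ _ => abs_nonneg _)
      (Finset.mem_univ B)

end Cones

end FineMixed

namespace FineMixed

/-! ### Continuation in the weight `c` and the limit `c → ∞` -/

section Continuation

open Set Topology Filter
open scoped NNReal

variable {n d : ℕ}

/-- `J` is the inverse of `weightedSum I c`, which is a bijection from the union of the cones onto
the nonnegative orthant. -/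
def IsInverse (𝓑 : Set (Fin n → Finset (Fin d))) (I : Finset (Fin n)) (c : ℝ)
    (J : (Fin d → ℝ) → Fin n → Fin d → ℝ) : Prop :=
  (∀ z, 0 ≤ z → (∃ B ∈ 𝓑, J z ∈ matrixCone B) ∧ weightedSum I c (J z) = z) ∧
    ∀ B ∈ 𝓑, ∀ N ∈ matrixCone B, J (weightedSum I c N) = N

theorem uniformContinuous_weightedSum (I : Finset (Fin n)) (c : ℝ) :
    UniformContinuous (weightedSum I c : (Fin n → Fin d → ℝ) → Fin d → ℝ) := by
  let T : (Fin n → Fin d → ℝ) →ₗ[ℝ] (Fin d → ℝ) :=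
    { toFun := weightedSum I c
      map_add' := fun N N' => by
        simp only [weightedSum, Pi.add_apply, Finset.sum_add_distrib, smul_add]
        abel
      map_smul' := fun r N => by
        ext a
        simp only [weightedSum_apply, Pi.smul_apply, smul_eq_mul, ← Finset.mul_sum,
          RingHom.id_apply]
        ring }
  exact T.toContinuousLinearMap.uniformContinuous

theorem weightedSum_nonneg {I : Finset (Fin n)} {c : ℝ} (hc : 0 ≤ c) {B : Fin n → Finset (Fin d)}
    {N : Fin n → Fin d → ℝ} (hN : N ∈ matrixCone B) : 0 ≤ weightedSum I c N := by
  intro a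
  rw [weightedSum_apply]
  exact add_nonneg (Finset.sum_nonneg fun m _ => hN.1 m a)
    (mul_nonneg hc (Finset.sum_nonneg fun m _ => hN.1 m a))

/-- On the image of each cone the inverse is Lipschitz by `hK`. These images are closed and cover
the convex orthant, so the bounds glue along segments. -/
theorem IsInverse.norm_sub_le {𝓑 : Set (Fin n → Finset (Fin d))} {K : ℝ} (hK0 : 0 ≤ K)
    {I : Finset (Fin n)} {c : ℝ} (hK : ∀ B ∈ 𝓑, ∀ N ∈ matrixCone B, ∀ N' ∈ matrixCone B,
      ‖N - N'‖ ≤ K * ‖weightedSum I c N - weightedSum I c N'‖)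
    {J : (Fin d → ℝ) → Fin n → Fin d → ℝ} (hJ : IsInverse 𝓑 I c J) {x y : Fin d → ℝ}
    (hx : 0 ≤ x) (hy : 0 ≤ y) : ‖J x - J y‖ ≤ K * ‖x - y‖ := by
  refine norm_sub_le_of_convex_of_closed_cover hK0 (convex_Ici (𝕜 := ℝ) (0 : Fin d → ℝ))
    (Z := fun B : 𝓑 => weightedSum I c '' matrixCone B.1) (fun B => ?_) (fun z hz => ?_)
    (fun B => ?_) hx hy
  · rw [← range_domRestrict]
    have := (isClosed_matrixCone B.1).completeSpace_coe
    refine AntilipschitzWith.isClosed_range (K := NNReal.mk K hK0) ?_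
      ((uniformContinuous_weightedSum I c).comp uniformContinuous_subtype_val)
    refine AntilipschitzWith.of_le_mul_dist fun N N' => ?_
    rw [Subtype.dist_eq, dist_eq_norm, dist_eq_norm]
    exact hK B.1 B.2 N N.2 N' N'.2
  · obtain ⟨⟨B, hB, hJB⟩, hz'⟩ := hJ.1 z hz
    exact mem_iUnion.2 ⟨⟨B, hB⟩, J z, hJB, hz'⟩
  · rintro _ ⟨N, hN, rfl⟩ _ ⟨N', hN', rfl⟩
    rw [hJ.2 B.1 B.2 N hN, hJ.2 B.1 B.2 N' hN']
    exact hK B.1 B.2 N hN N' hN'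

theorem norm_sum_sub_sum_le (I : Finset (Fin n)) (N N' : Fin n → Fin d → ℝ) :
    ‖∑ m ∈ I, N m - ∑ m ∈ I, N' m‖ ≤ n * ‖N - N'‖ := by
  rw [← Finset.sum_sub_distrib]
  refine (norm_sum_le _ _).trans ?_
  refine (Finset.sum_le_card_nsmul I _ ‖N - N'‖ fun m _ => norm_le_pi_norm (N - N') m).trans ?_
  rw [nsmul_eq_mul]
  gcongr
  simpa using I.card_le_univ

/-- Inverting at `c + δ` means solving `N = J (y - δ ∑_I N)`, a fixed point of a contraction for
small `δ`. The argument of `J` is truncated at `0` to keep it in the orthant. -/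
theorem IsInverse.exists_add {𝓑 : Set (Fin n → Finset (Fin d))} {K : ℝ} (hK0 : 0 ≤ K)
    {I : Finset (Fin n)} {c δ : ℝ} (hc : 0 ≤ c) (hδ : 0 ≤ δ) (hδK : K * (δ * n) < 1)
    {J : (Fin d → ℝ) → Fin n → Fin d → ℝ} (hJ : IsInverse 𝓑 I c J)
    (hK : ∀ B ∈ 𝓑, ∀ N ∈ matrixCone B, ∀ N' ∈ matrixCone B,
      ‖N - N'‖ ≤ K * ‖weightedSum I c N - weightedSum I c N'‖) :
    ∃ J', IsInverse 𝓑 I (c + δ) J' := by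
  let Θ : (Fin d → ℝ) → (Fin n → Fin d → ℝ) → Fin n → Fin d → ℝ := fun y N =>
    J fun a => max (y a - δ * ∑ m ∈ I, N m a) 0
  have hΘ : ∀ y, ContractingWith (NNReal.mk (K * (δ * n)) (by positivity)) (Θ y) := by
    refine fun y => ⟨hδK, LipschitzWith.of_dist_le_mul fun N N' => ?_⟩
    rw [dist_eq_norm, dist_eq_norm]
    have hmax : ∀ N : Fin n → Fin d → ℝ,
        (0 : Fin d → ℝ) ≤ fun a => max (y a - δ * ∑ m ∈ I, N m a) 0 :=
      fun N a => le_max_right _ _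
    refine (hJ.norm_sub_le hK0 hK (hmax N) (hmax N')).trans ?_
    rw [NNReal.coe_mk, mul_assoc]
    refine mul_le_mul_of_nonneg_left ?_ hK0
    refine (pi_norm_le_iff_of_nonneg (by positivity)).2 fun a => ?_
    rw [Pi.sub_apply, Real.norm_eq_abs]
    refine (abs_max_sub_max_le_abs _ _ _).trans ?_
    have h1 : |∑ m ∈ I, N m a - ∑ m ∈ I, N' m a| ≤ n * ‖N - N'‖ := by
      refine le_trans ?_ (norm_sum_sub_sum_le I N N')
      refine le_trans (le_of_eq ?_) (norm_le_pi_norm _ a)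
      simp [Finset.sum_apply]
    calc |y a - δ * ∑ m ∈ I, N m a - (y a - δ * ∑ m ∈ I, N' m a)|
        = δ * |∑ m ∈ I, N m a - ∑ m ∈ I, N' m a| := by
          rw [← abs_of_nonneg hδ, ← abs_mul, abs_of_nonneg hδ, ← abs_neg]
          congr 1; ring
      _ ≤ δ * (n * ‖N - N'‖) := by gcongr
      _ = δ * n * ‖N - N'‖ := by ring
  have hsplit : ∀ N : Fin n → Fin d → ℝ, ∀ a,
      weightedSum I (c + δ) N a = weightedSum I c N a + δ * ∑ m ∈ I, N m a := fun N a => by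
    rw [weightedSum_apply, weightedSum_apply]; ring
  refine ⟨fun y => (hΘ y).fixedPoint, fun y hy => ?_, fun B hB N hN => ?_⟩
  · set N := (hΘ y).fixedPoint with hNdef
    have hfix : J (fun a => max (y a - δ * ∑ m ∈ I, N m a) 0) = N := (hΘ y).fixedPoint_isFixedPt
    obtain ⟨⟨B, hB, hNB⟩, hw⟩ := hJ.1 (fun a => max (y a - δ * ∑ m ∈ I, N m a) 0)
      (show (0 : Fin d → ℝ) ≤ _ from fun a => le_max_right _ _)
    rw [hfix] at hNB hw
    refine ⟨⟨B, hB, hNB⟩, funext fun a => ?_⟩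
    have hwa := congrFun hw a
    rw [hsplit, hwa]
    -- The truncation does no harm at the fixed point: where it acts, column `a` of `N` has weighted
    -- sum `0`, so its part in `I` vanishes, and then `y a = 0`.
    rcases le_total 0 (y a - δ * ∑ m ∈ I, N m a) with h | h
    · rw [max_eq_left h]; ring
    · rw [max_eq_right h] at hwa ⊢
      rw [weightedSum_apply] at hwa
      have h1 : 0 ≤ ∑ m, N m a := Finset.sum_nonneg fun m _ => hNB.1 m a
      have h2 : 0 ≤ ∑ m ∈ I, N m a := Finset.sum_nonneg fun m _ => hNB.1 m a
      have h3 : ∑ m ∈ I, N m a ≤ ∑ m, N m a :=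
        Finset.sum_le_sum_of_subset_of_nonneg (Finset.subset_univ _) fun m _ _ => hNB.1 m a
      have h4 : ∑ m ∈ I, N m a = 0 := by nlinarith [mul_nonneg hc h2]
      rw [h4] at h ⊢
      have := hy a
      simp only [Pi.zero_apply] at this
      linarith
  · refine ((hΘ _).fixedPoint_unique ?_).symm
    change J _ = N
    have : (fun a => max (weightedSum I (c + δ) N a - δ * ∑ m ∈ I, N m a) 0) =
        weightedSum I c N := by
      funext a
      rw [hsplit, add_sub_cancel_right]
      exact max_eq_left (weightedSum_nonneg hc hN a)
    rw [this]
    exact hJ.2 B hB N hN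

/-- Matrices with unit row sums are bounded, so a subsequence converges; dividing the equation by
`c` leaves only the partial sum over `I`. The closed set `Q` carries a side condition through the
limit. -/
theorem exists_limit {𝓑 : Set (Fin n → Finset (Fin d))} {I : Finset (Fin n)}
    {Q : Set (Fin n → Fin d → ℝ)} (hQ : IsClosed Q) {y : Fin d → ℝ} {R : ℝ}
    (h : ∀ k : ℕ, ∃ c : ℝ, (k : ℝ) + 1 ≤ c ∧ ∃ N ∈ Q, (∃ B ∈ 𝓑, N ∈ matrixCone B) ∧
      (∀ m, ∑ a, N m a = 1) ∧ ∃ u : Fin d → ℝ, ‖u‖ ≤ R ∧ weightedSum I c N = u + c • y) :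
    ∃ N ∈ Q, (∃ B ∈ 𝓑, N ∈ matrixCone B) ∧ (∀ m, ∑ a, N m a = 1) ∧ ∑ m ∈ I, N m = y := by
  choose c hc N hNQ hNB hrow u hu hw using h
  have hball : ∀ k, N k ∈ Metric.closedBall (0 : Fin n → Fin d → ℝ) 1 := by
    intro k
    obtain ⟨B, -, hB⟩ := hNB k
    rw [mem_closedBall_zero_iff]
    refine (pi_norm_le_iff_of_nonneg zero_le_one).2 fun m =>
      (pi_norm_le_iff_of_nonneg zero_le_one).2 fun a => ?_
    rw [Real.norm_eq_abs, abs_of_nonneg (hB.1 m a), ← hrow k m]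
    exact Finset.single_le_sum (fun a _ => hB.1 m a) (Finset.mem_univ a)
  obtain ⟨N₀, -, φ, hφ, hlim⟩ := (isCompact_closedBall _ _).tendsto_subseq hball
  have hclosed : IsClosed (⋃ B : 𝓑, matrixCone B.1) :=
    isClosed_iUnion_of_finite fun B => isClosed_matrixCone B.1
  refine ⟨N₀, hQ.mem_of_tendsto hlim (Eventually.of_forall fun k => hNQ _), ?_, fun m => ?_, ?_⟩
  · have := hclosed.mem_of_tendsto hlim (Eventually.of_forall fun k => by
      obtain ⟨B, hB, h⟩ := hNB (φ k)
      exact mem_iUnion.2 ⟨⟨B, hB⟩, h⟩)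
    obtain ⟨⟨B, hB⟩, h⟩ := mem_iUnion.1 this
    exact ⟨B, hB, h⟩
  · have hcont : Continuous fun N : Fin n → Fin d → ℝ => ∑ a, N m a := by fun_prop
    refine tendsto_nhds_unique ((hcont.tendsto N₀).comp hlim) ?_
    exact tendsto_const_nhds.congr fun k => (hrow (φ k) m).symm
  · have hcont : Continuous fun N : Fin n → Fin d → ℝ => ∑ m ∈ I, N m := by fun_prop
    refine tendsto_nhds_unique ((hcont.tendsto N₀).comp hlim) ?_
    have hbd : ∀ k, ‖∑ m ∈ I, N k m - y‖ ≤ (R + n) * (1 / ((k : ℝ) + 1)) := by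
      intro k
      have hk : (0 : ℝ) < (k : ℝ) + 1 := by positivity
      have hck : 0 < c k := hk.trans_le (hc k)
      have h1 : c k • (∑ m ∈ I, N k m - y) = u k - ∑ m, N k m := by
        have := hw k
        simp only [weightedSum] at this
        rw [smul_sub, sub_eq_sub_iff_add_eq_add, ← this]
        abel
      have h2 : ‖∑ m, N k m‖ ≤ n := by
        have h3 := norm_sum_sub_sum_le Finset.univ (N k) 0
        have h4 : ‖N k‖ ≤ 1 := by simpa using hball k
        simp only [Pi.zero_apply, Finset.sum_const_zero, sub_zero] at h3
        refine h3.trans ?_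
        have : (0 : ℝ) ≤ n := by positivity
        nlinarith
      have h3 : c k * ‖∑ m ∈ I, N k m - y‖ ≤ R + n := by
        rw [← Real.norm_of_nonneg hck.le, ← norm_smul, h1]
        exact (norm_sub_le _ _).trans (add_le_add (hu k) h2)
      rw [mul_one_div, le_div_iff₀ hk, mul_comm]
      exact (mul_le_mul_of_nonneg_right (hc k) (norm_nonneg _)).trans h3
    rw [tendsto_iff_norm_sub_tendsto_zero]
    refine squeeze_zero (fun k => norm_nonneg _) (fun k => hbd (φ k)) ?_
    have := (tendsto_one_div_add_atTop_nhds_zero_nat (𝕜 := ℝ)).const_mul (R + n)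
    rw [mul_zero] at this
    exact this.comp hφ.tendsto_atTop

/-- The step `δ` depends only on the uniform `K`, so finitely many equal steps pass any bound `r`.
-/
theorem exists_isInverse_of_le {𝓑 : Set (Fin n → Finset (Fin d))}
    (hind : ∀ B ∈ 𝓑, SumsInjective B) {J₀ : (Fin d → ℝ) → Fin n → Fin d → ℝ}
    (I : Finset (Fin n)) (hJ₀ : IsInverse 𝓑 I 0 J₀) :
    ∃ K : ℝ, 0 ≤ K ∧ ∀ r : ℝ, ∃ c, r ≤ c ∧ 0 ≤ c ∧ ∃ J, IsInverse 𝓑 I c J ∧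
      ∀ x y, 0 ≤ x → 0 ≤ y → ‖J x - J y‖ ≤ K * ‖x - y‖ := by
  obtain ⟨K, hK0, hK⟩ := exists_uniform_norm_le 𝓑 hind
  set δ : ℝ := 1 / (K * n + 1) with hδdef
  have hδ : 0 < δ := by positivity
  have hδK : K * (δ * n) < 1 := by
    have : K * (δ * n) = (K * n) / (K * n + 1) := by rw [hδdef]; field_simp
    rw [this, div_lt_one (by positivity)]
    linarith
  have hstep : ∀ k : ℕ, ∃ J, IsInverse 𝓑 I (k * δ) J := by
    intro k
    induction k with
    | zero => exact ⟨J₀, by simpa using hJ₀⟩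
    | succ k ih =>
      obtain ⟨J, hJ⟩ := ih
      have h0 : (0 : ℝ) ≤ k * δ := by positivity
      obtain ⟨J', hJ'⟩ := hJ.exists_add hK0 h0 hδ.le hδK
        fun B hB N hN N' hN' => hK B hB I _ h0 N hN N' hN'
      refine ⟨J', ?_⟩
      convert hJ' using 1
      push_cast; ring
  refine ⟨K, hK0, fun r => ?_⟩
  obtain ⟨k, hk⟩ := exists_nat_ge (r / δ)
  have h0 : (0 : ℝ) ≤ k * δ := by positivity
  obtain ⟨J, hJ⟩ := hstep k
  exact ⟨k * δ, by rwa [div_le_iff₀ hδ] at hk, h0, J, hJ, fun x y hx hy =>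
    hJ.norm_sub_le hK0 (fun B hB N hN N' hN' => hK B hB I _ h0 N hN N' hN') hx hy⟩

theorem sum_weightedSum {B : Fin n → Finset (Fin d)} {N : Fin n → Fin d → ℝ}
    (hN : N ∈ matrixCone B) (I : Finset (Fin n)) (c : ℝ) (m : Fin n) :
    ∑ a, weightedSum I c N a = (n + c * I.card) * ∑ a, N m a := by
  simp only [weightedSum_apply, Finset.sum_add_distrib, ← Finset.mul_sum]
  rw [Finset.sum_comm, Finset.sum_comm (s := Finset.univ) (t := I)]
  simp only [hN.2.2 _ m, Finset.sum_const, Finset.card_univ, Fintype.card_fin, nsmul_eq_mul]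
  ring

theorem row_sum_eq_one (hn : 0 < n) {B : Fin n → Finset (Fin d)} {N : Fin n → Fin d → ℝ}
    (hN : N ∈ matrixCone B) {I : Finset (Fin n)} {c : ℝ} (hc : 0 ≤ c)
    (h : ∑ a, weightedSum I c N a = n + c * I.card) (m : Fin n) : ∑ a, N m a = 1 := by
  rw [sum_weightedSum hN I c m] at h
  have : (0 : ℝ) < n + c * I.card := by positivity
  exact (mul_eq_left₀ this.ne').1 h

/-- Every point of `|I|Δ` is a partial sum of the rows of a matrix in one of the cones. -/
theorem exists_partial_sum_eq (hn : 0 < n) {𝓑 : Set (Fin n → Finset (Fin d))}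
    (hind : ∀ B ∈ 𝓑, SumsInjective B) {I : Finset (Fin n)} (hI : I.Nonempty)
    {J₀ : (Fin d → ℝ) → Fin n → Fin d → ℝ} (hJ₀ : IsInverse 𝓑 I 0 J₀) {y : Fin d → ℝ}
    (hy : 0 ≤ y) (hys : ∑ a, y a = I.card) :
    ∃ N, (∀ m a, y a = 0 → N m a = 0) ∧ (∃ B ∈ 𝓑, N ∈ matrixCone B) ∧
      (∀ m, ∑ a, N m a = 1) ∧ ∑ m ∈ I, N m = y := by
  obtain ⟨K, -, hJ⟩ := exists_isInverse_of_le hind I hJ₀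
  have hIc : (0 : ℝ) < I.card := by exact_mod_cast hI.card_pos
  -- This multiple of `y` makes the total mass of `u + c • y` equal to `n + c |I|`, which forces
  -- unit row sums. It vanishes wherever `y` does, so whole columns of the preimage vanish there.
  set u : Fin d → ℝ := ((n : ℝ) / I.card) • y with hu
  refine exists_limit (Q := {N | ∀ m a, y a = 0 → N m a = 0}) ?_ (R := ‖u‖) fun k => ?_
  · simp only [Set.ofPred_forall]
    exact isClosed_iInter fun m => isClosed_iInter fun a => isClosed_iInter fun _ =>
      isClosed_eq (by fun_prop) (by fun_prop)
  obtain ⟨c, hkc, hc, J, hJ, -⟩ := hJ (k + 1)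
  have hz : 0 ≤ u + c • y := fun a => by
    simp only [hu, Pi.add_apply, Pi.smul_apply, smul_eq_mul, Pi.zero_apply]
    have : 0 ≤ y a := hy a
    positivity
  obtain ⟨⟨B, hB, hJB⟩, hw⟩ := hJ.1 _ hz
  refine ⟨c, hkc, J (u + c • y), fun m a ha => ?_, ⟨B, hB, hJB⟩, ?_, u, le_rfl, hw⟩
  · have := congrFun hw a
    rw [weightedSum_apply] at this
    simp only [hu, Pi.add_apply, Pi.smul_apply, smul_eq_mul, ha, mul_zero, add_zero] at this
    have h1 : 0 ≤ ∑ m, J (u + c • y) m a := Finset.sum_nonneg fun m _ => hJB.1 m a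
    have h2 : 0 ≤ c * ∑ m ∈ I, J (u + c • y) m a :=
      mul_nonneg hc (Finset.sum_nonneg fun m _ => hJB.1 m a)
    have h3 : ∑ m, J (u + c • y) m a = 0 := by linarith
    exact (Finset.sum_eq_zero_iff_of_nonneg fun m _ => hJB.1 m a).1 h3 m (Finset.mem_univ m)
  · refine row_sum_eq_one hn hJB (I := I) hc ?_
    rw [hw]
    simp only [hu, Pi.add_apply, Pi.smul_apply, smul_eq_mul, Finset.sum_add_distrib,
      ← Finset.mul_sum, hys]
    field_simp

/-- An entry takes all intermediate values on the matrices with a given partial sum of rows. -/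
theorem exists_entry_eq (hn : 0 < n) {𝓑 : Set (Fin n → Finset (Fin d))}
    (hind : ∀ B ∈ 𝓑, SumsInjective B) {I : Finset (Fin n)}
    {J₀ : (Fin d → ℝ) → Fin n → Fin d → ℝ} (hJ₀ : IsInverse 𝓑 I 0 J₀)
    {N₁ N₂ : Fin n → Fin d → ℝ} (h₁ : ∃ B ∈ 𝓑, N₁ ∈ matrixCone B)
    (h₂ : ∃ B ∈ 𝓑, N₂ ∈ matrixCone B) (hr₁ : ∀ m, ∑ a, N₁ m a = 1) (hr₂ : ∀ m, ∑ a, N₂ m a = 1)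
    (hs : ∑ m ∈ I, N₁ m = ∑ m ∈ I, N₂ m) (m : Fin n) (a : Fin d) {r : ℝ}
    (hr : r ∈ Icc (N₁ m a) (N₂ m a)) :
    ∃ N : Fin n → Fin d → ℝ, N m a = r ∧ (∃ B ∈ 𝓑, N ∈ matrixCone B) ∧
      (∀ m, ∑ a, N m a = 1) ∧ ∑ m ∈ I, N m = ∑ m ∈ I, N₁ m := by
  obtain ⟨K, hK0, hJ⟩ := exists_isInverse_of_le hind I hJ₀
  obtain ⟨B₁, hB₁, hN₁⟩ := h₁
  obtain ⟨B₂, hB₂, hN₂⟩ := h₂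
  set y := ∑ m ∈ I, N₁ m with hy
  set p₁ := ∑ m, N₁ m with hp₁
  set p₂ := ∑ m, N₂ m with hp₂
  refine exists_limit (Q := {N | N m a = r}) (isClosed_eq (by fun_prop) (by fun_prop))
    (R := ‖p₁‖ + ‖p₂‖) fun k => ?_
  obtain ⟨c, hkc, hc, J, hJ, hLip⟩ := hJ (k + 1)
  -- The inverse carries this segment to a continuous path from `N₁` to `N₂` inside the union of the
  -- cones. Only the bounded part of the right-hand side varies along it, so the partial sum is `y`
  -- in the limit.
  let z : ℝ → Fin d → ℝ := fun s => AffineMap.lineMap (p₁ + c • y) (p₂ + c • y) s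
  have hw₁ : weightedSum I c N₁ = p₁ + c • y := rfl
  have hw₂ : weightedSum I c N₂ = p₂ + c • y := by rw [hs]; rfl
  have hz : ∀ s ∈ Icc (0 : ℝ) 1, 0 ≤ z s := fun s hs =>
    (convex_Ici (𝕜 := ℝ) (0 : Fin d → ℝ)).lineMap_mem
      (hw₁ ▸ weightedSum_nonneg hc hN₁ : (0 : Fin d → ℝ) ≤ _)
      (hw₂ ▸ weightedSum_nonneg hc hN₂ : (0 : Fin d → ℝ) ≤ _) hs
  have hcont : ContinuousOn (fun s => J (z s) m a) (Icc 0 1) := by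
    have hJc : ContinuousOn J {x | 0 ≤ x} :=
      (LipschitzOnWith.of_dist_le_mul (K := NNReal.mk K hK0) fun x hx y hy => by
        rw [dist_eq_norm, dist_eq_norm]; exact hLip x y hx hy).continuousOn
    have hzc : ContinuousOn z (Icc 0 1) := AffineMap.lineMap_continuous.continuousOn
    have h := hJc.comp hzc hz
    have hent : Continuous fun N : Fin n → Fin d → ℝ => N m a := by fun_prop
    exact hent.comp_continuousOn h
  have h0 : J (z 0) = N₁ := by
    simp only [z, AffineMap.lineMap_apply_zero]
    rw [← hw₁]; exact hJ.2 B₁ hB₁ N₁ hN₁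
  have h1 : J (z 1) = N₂ := by
    simp only [z, AffineMap.lineMap_apply_one]
    rw [← hw₂]; exact hJ.2 B₂ hB₂ N₂ hN₂
  obtain ⟨s, hs01, hsr⟩ := intermediate_value_Icc zero_le_one hcont
    (show r ∈ Icc (J (z 0) m a) (J (z 1) m a) by rwa [h0, h1])
  obtain ⟨hcone, hw⟩ := hJ.1 (z s) (hz s hs01)
  have hzs : z s = AffineMap.lineMap p₁ p₂ s + c • y := by
    simp only [z, AffineMap.lineMap_apply_module]
    module
  refine ⟨c, hkc, J (z s), hsr, hcone, ?_, AffineMap.lineMap p₁ p₂ s, ?_, hw.trans hzs⟩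
  · obtain ⟨B, hB, hJB⟩ := hcone
    refine row_sum_eq_one hn hJB (I := I) hc ?_
    rw [hw]
    simp only [z, AffineMap.lineMap_apply_module, Pi.add_apply, Pi.smul_apply, smul_eq_mul,
      Finset.sum_add_distrib, ← Finset.mul_sum]
    have e1 := sum_weightedSum hN₁ I c m
    have e2 := sum_weightedSum hN₂ I c m
    rw [hw₁, hr₁] at e1
    rw [hw₂, hr₂] at e2
    simp only [Pi.add_apply, Pi.smul_apply, smul_eq_mul, Finset.sum_add_distrib,
      ← Finset.mul_sum] at e1 e2
    rw [e1, e2]; ring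
  · rw [AffineMap.lineMap_apply_module]
    refine (norm_add_le _ _).trans ?_
    rw [norm_smul, norm_smul, Real.norm_of_nonneg hs01.1, Real.norm_of_nonneg (by linarith [hs01.2])]
    nlinarith [norm_nonneg p₁, norm_nonneg p₂, hs01.1, hs01.2]

/-- Put `w_a - w_b` in row `i` and its negative in row `j`: all row and column sums vanish. -/
theorem SumsInjective.false_of_shared_pair {B : Fin n → Finset (Fin d)} (hB : SumsInjective B)
    {i j : Fin n} (hij : i ≠ j) {a b : Fin d} (hab : a ≠ b) (hia : a ∈ B i) (hib : b ∈ B i)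
    (hja : a ∈ B j) (hjb : b ∈ B j) : False := by
  let D : Fin d → ℝ := Pi.single a 1 - Pi.single b 1
  have hD0 : ∀ e, e ≠ a → e ≠ b → D e = 0 := fun e ha hb => by simp [D, ha, hb]
  have := hB (Pi.single i D - Pi.single j D) (fun m e he => ?_) (fun m => ?_) ?_
  · have h := congrFun (congrFun this i) a
    simp [hij, D, hab] at h
  · rcases eq_or_ne m i with rfl | hmi
    · simp only [Pi.sub_apply, Pi.single_eq_same, Pi.single_eq_of_ne hij, Pi.zero_apply, sub_zero]
      exact hD0 e (fun h => he (h ▸ hia)) (fun h => he (h ▸ hib))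
    · rcases eq_or_ne m j with rfl | hmj
      · simp only [Pi.sub_apply, Pi.single_eq_same, Pi.single_eq_of_ne hmi, Pi.zero_apply,
          zero_sub, neg_eq_zero]
        exact hD0 e (fun h => he (h ▸ hja)) (fun h => he (h ▸ hjb))
      · simp [hmi, hmj]
  · have hDs : ∑ e, D e = 0 := by simp [D]
    simp only [Pi.sub_apply, Finset.sum_sub_distrib, Pi.single_apply, ite_apply]
    by_cases hmi : m = i <;> by_cases hmj : m = j <;> simp [hmi, hmj, hDs]
  · simp [Finset.sum_sub_distrib]

/-- The union of the cones does not contain two matrices in which two rows are exchanged unit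
vectors. -/
theorem not_exchange (hn : 0 < n) {𝓑 : Set (Fin n → Finset (Fin d))}
    (hind : ∀ B ∈ 𝓑, SumsInjective B) {i j : Fin n} (hij : i ≠ j)
    {J₀ : (Fin d → ℝ) → Fin n → Fin d → ℝ} (hJ₀ : IsInverse 𝓑 {i, j} 0 J₀)
    {N₁ N₂ : Fin n → Fin d → ℝ} (h₁ : ∃ B ∈ 𝓑, N₁ ∈ matrixCone B)
    (h₂ : ∃ B ∈ 𝓑, N₂ ∈ matrixCone B) (hr₁ : ∀ m, ∑ a, N₁ m a = 1) (hr₂ : ∀ m, ∑ a, N₂ m a = 1)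
    {a b : Fin d} (hab : a ≠ b) (h₁i : N₁ i = Pi.single b 1) (h₁j : N₁ j = Pi.single a 1)
    (h₂i : N₂ i = Pi.single a 1) (h₂j : N₂ j = Pi.single b 1) : False := by
  -- Both partial sums are `w_a + w_b`, and the entry `(i, a)` goes from `0` to `1`. At the value
  -- `1/2`, rows `i` and `j` are both the midpoint of `w_a w_b`.
  obtain ⟨N, hNr, ⟨B, hB, hN⟩, hrow, hsum⟩ := exists_entry_eq hn hind hJ₀ h₁ h₂ hr₁ hr₂
    (by rw [Finset.sum_pair hij, Finset.sum_pair hij, h₁i, h₁j, h₂i, h₂j, add_comm]) i a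
    (r := 1 / 2) (by rw [h₁i, h₂i]; simp [hab]; norm_num)
  rw [Finset.sum_pair hij, Finset.sum_pair hij, h₁i, h₁j] at hsum
  have hoff : ∀ e, e ≠ a → e ≠ b → N i e = 0 := fun e hea heb => by
    have := congrFun hsum e
    simp only [Pi.add_apply, Pi.single_eq_of_ne heb, Pi.single_eq_of_ne hea] at this
    linarith [hN.1 i e, hN.1 j e]
  have hib : N i b = 1 / 2 := by
    have := hrow i
    rw [← Finset.sum_subset (Finset.subset_univ {a, b}) (fun e _ he => by
      simp only [Finset.mem_insert, Finset.mem_singleton, not_or] at he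
      exact hoff e he.1 he.2), Finset.sum_pair hab] at this
    linarith
  have hja : N j a = 1 / 2 := by
    have := congrFun hsum a
    simp [hab] at this
    linarith
  have hjb : N j b = 1 / 2 := by
    have := congrFun hsum b
    simp [hab.symm] at this
    linarith
  have hmem : ∀ m e, N m e = 1 / 2 → e ∈ B m := fun m e h => by
    by_contra h'
    rw [hN.2.1 m e h'] at h
    norm_num at h
  exact (hind B hB).false_of_shared_pair hij hab (hmem i a hNr) (hmem i b hib) (hmem j a hja)
    (hmem j b hjb)

end Continuation

end FineMixed

namespace FineMixed

/-! ### Faces and unique decompositions within one fine cell -/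

section Geometry

variable {n d : ℕ}

theorem mem_simplexFace {A : Finset (Fin d)} {x : Fin d → ℝ} :
    x ∈ simplexFace A ↔ (∀ a, 0 ≤ x a) ∧ (∀ a ∉ A, x a = 0) ∧ ∑ a, x a = 1 := by
  constructor
  · intro hx
    have hconv : Convex ℝ
        {x : Fin d → ℝ | (∀ a, 0 ≤ x a) ∧ (∀ a ∉ A, x a = 0) ∧ ∑ a, x a = 1} := by
      rintro x ⟨hx1, hx2, hx3⟩ y ⟨hy1, hy2, hy3⟩ s t hs ht hst
      refine ⟨fun a => ?_, fun a ha => ?_, ?_⟩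
      · have := hx1 a
        have := hy1 a
        simp only [Pi.add_apply, Pi.smul_apply, smul_eq_mul]
        positivity
      · simp [hx2 a ha, hy2 a ha]
      · simp [Finset.sum_add_distrib, ← Finset.mul_sum, hx3, hy3, hst]
    refine convexHull_min ?_ hconv hx
    rintro _ ⟨a, ha, rfl⟩
    refine ⟨fun b => ?_, fun b hb => ?_, by simp⟩
    · by_cases h : b = a <;> simp [h]
    · exact Pi.single_eq_of_ne (fun h => hb (by rw [h]; exact ha)) _
  · rintro ⟨h1, h2, h3⟩
    have hx : x = ∑ a ∈ A, x a • (Pi.single a 1 : Fin d → ℝ) := by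
      ext b
      simp only [Finset.sum_apply, Pi.smul_apply, smul_eq_mul, Pi.single_apply, mul_ite, mul_one,
        mul_zero, Finset.sum_ite_eq]
      split_ifs with hb
      · rfl
      · exact h2 b hb
    rw [hx]
    refine (convex_convexHull ℝ _).sum_mem (fun a _ => h1 a) ?_ fun a ha =>
      subset_convexHull ℝ _ ⟨a, ha, rfl⟩
    rw [← h3]
    exact Finset.sum_subset (Finset.subset_univ A) fun a _ ha => h2 a ha

theorem single_mem_simplexFace {A : Finset (Fin d)} {a : Fin d} (ha : a ∈ A) :
    (Pi.single a 1 : Fin d → ℝ) ∈ simplexFace A :=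
  subset_convexHull ℝ _ ⟨a, ha, rfl⟩

theorem simplexFace_mono {A A' : Finset (Fin d)} (h : A ⊆ A') : simplexFace A ⊆ simplexFace A' :=
  convexHull_mono (Set.image_mono (by exact_mod_cast h))

theorem mem_minkowskiSum {B : Fin n → Finset (Fin d)} {x : Fin d → ℝ} :
    x ∈ minkowskiSum B ↔ ∃ M : Fin n → Fin d → ℝ, (∀ m, M m ∈ simplexFace (B m)) ∧
      ∑ m, M m = x := by
  simp [minkowskiSum, Set.mem_fintype_sum]

/-- A row of sum zero supported in `B m` is a combination of differences of vertices, so it lies in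
the direction of the `m`-th summand. -/
theorem IsFine.sumsInjective {B : Fin n → Finset (Fin d)} (hB : IsFine B) : SumsInjective B := by
  intro N hN hrow hcol
  have h := (iSupIndep_iff_finsetSum_eq_zero_imp_eq_zero _).1 hB.2 Finset.univ N
    (fun m _ => ?_) hcol
  · exact funext fun m => h m (Finset.mem_univ m)
  · obtain ⟨b, hb⟩ := hB.1 m
    have : N m = ∑ a ∈ B m, N m a • ((Pi.single a 1 : Fin d → ℝ) - Pi.single b 1) := by
      have hs : ∑ a ∈ B m, N m a = 0 := by
        rw [← hrow m]
        exact Finset.sum_subset (Finset.subset_univ _) fun a _ ha => hN m a ha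
      simp only [smul_sub, Finset.sum_sub_distrib, ← Finset.sum_smul, hs, zero_smul, sub_zero]
      ext a
      simp only [Finset.sum_apply, Pi.smul_apply, smul_eq_mul, Pi.single_apply, mul_ite, mul_one,
        mul_zero, Finset.sum_ite_eq]
      split_ifs with ha
      · rfl
      · exact hN m a ha
    rw [this]
    exact Submodule.sum_mem _ fun a ha => Submodule.smul_mem _ _
      (vsub_mem_vectorSpan ℝ (single_mem_simplexFace ha) (single_mem_simplexFace hb))

theorem SumsInjective.eq_of_sum_eq {B : Fin n → Finset (Fin d)} (hB : SumsInjective B)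
    {M M' : Fin n → Fin d → ℝ} (hM : ∀ m, M m ∈ simplexFace (B m))
    (hM' : ∀ m, M' m ∈ simplexFace (B m)) (h : ∑ m, M m = ∑ m, M' m) : M = M' := by
  refine sub_eq_zero.1 (hB (M - M') (fun m a ha => ?_) (fun m => ?_) ?_)
  · simp [(mem_simplexFace.1 (hM m)).2.1 a ha, (mem_simplexFace.1 (hM' m)).2.1 a ha]
  · simp [(mem_simplexFace.1 (hM m)).2.2, (mem_simplexFace.1 (hM' m)).2.2]
  · simp [h]

/-- Within one cell the rows depend affinely on their sum, so the mass that they put on `F` is, up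
to a constant, a functional of the sum. It will expose the subsum given by `F`. -/
theorem SumsInjective.exists_functional {B : Fin n → Finset (Fin d)} (hB : SumsInjective B)
    (F : Fin n → Finset (Fin d)) :
    ∃ l : StrongDual ℝ (Fin d → ℝ), ∀ M M' : Fin n → Fin d → ℝ,
      (∀ m, M m ∈ simplexFace (B m)) → (∀ m, M' m ∈ simplexFace (B m)) →
        l (∑ m, M m) - l (∑ m, M' m) =
          ∑ m, ∑ a ∈ F m, M m a - ∑ m, ∑ a ∈ F m, M' m a := by
  obtain ⟨g, hg⟩ := (sumsAndOutside B).exists_leftInverse_of_injective hB.ker_eq_bot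
  let s : (Fin n → Fin d → ℝ) →ₗ[ℝ] ℝ :=
    { toFun := fun N => ∑ m, ∑ a ∈ F m, N m a
      map_add' := fun N N' => by simp [Finset.sum_add_distrib]
      map_smul' := fun r N => by simp [Finset.mul_sum] }
  let l : (Fin d → ℝ) →ₗ[ℝ] ℝ :=
    s ∘ₗ g ∘ₗ LinearMap.inr ℝ (Fin n → ℝ) _ ∘ₗ LinearMap.inl ℝ _ (Fin n → Fin d → ℝ)
  refine ⟨l.toContinuousLinearMap, fun M M' hM hM' => ?_⟩
  rw [LinearMap.coe_toContinuousLinearMap', ← map_sub]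
  have hT : sumsAndOutside B (M - M') = (0, ∑ m, M m - ∑ m, M' m, 0) := by
    refine Prod.ext ?_ (Prod.ext ?_ ?_)
    · ext m
      simp [sumsAndOutside, (mem_simplexFace.1 (hM m)).2.2, (mem_simplexFace.1 (hM' m)).2.2]
    · simp [sumsAndOutside]
    · ext m a
      by_cases h : a ∈ B m
      · simp [sumsAndOutside, h]
      · simp [sumsAndOutside, h, (mem_simplexFace.1 (hM m)).2.1 a h,
          (mem_simplexFace.1 (hM' m)).2.1 a h]
  have hgT : g (0, ∑ m, M m - ∑ m, M' m, 0) = M - M' := by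
    rw [← hT]; exact LinearMap.congr_fun hg (M - M')
  change s (g (0, ∑ m, M m - ∑ m, M' m, 0)) = _
  rw [hgT, map_sub]
  rfl

theorem sum_le_one_of_mem_simplexFace {A F : Finset (Fin d)} {x : Fin d → ℝ}
    (hx : x ∈ simplexFace A) : ∑ a ∈ F, x a ≤ 1 := by
  obtain ⟨h1, -, h3⟩ := mem_simplexFace.1 hx
  rw [← h3]
  exact Finset.sum_le_sum_of_subset_of_nonneg (Finset.subset_univ _) fun a _ _ => h1 a

theorem sum_eq_one_of_mem_simplexFace {F : Finset (Fin d)} {x : Fin d → ℝ}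
    (hx : x ∈ simplexFace F) : ∑ a ∈ F, x a = 1 := by
  obtain ⟨-, h2, h3⟩ := mem_simplexFace.1 hx
  rw [← h3]
  exact Finset.sum_subset (Finset.subset_univ _) fun a _ ha => h2 a ha

theorem mem_simplexFace_of_sum_eq_one {A F : Finset (Fin d)} {x : Fin d → ℝ}
    (hx : x ∈ simplexFace A) (h : ∑ a ∈ F, x a = 1) : x ∈ simplexFace F := by
  obtain ⟨h1, -, h3⟩ := mem_simplexFace.1 hx
  refine mem_simplexFace.2 ⟨h1, fun a ha => ?_, h3⟩
  have h4 : x a + ∑ a ∈ F, x a ≤ 1 := by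
    rw [← Finset.sum_insert ha, ← h3]
    exact Finset.sum_le_sum_of_subset_of_nonneg (Finset.subset_univ _) fun a _ _ => h1 a
  linarith [h1 a]

/-- The mass on `F` is at most `1` per row, and total mass `n` is reached exactly when every row
lies in its face `F m`. -/
theorem SumsInjective.isExposed {B F : Fin n → Finset (Fin d)} (hB : SumsInjective B)
    (hFB : ∀ m, F m ⊆ B m) (hF : ∀ m, (F m).Nonempty) :
    IsExposed ℝ (minkowskiSum B) (minkowskiSum F) := by
  intro _
  obtain ⟨l, hl⟩ := hB.exists_functional F
  choose f hf using hF
  have hle : ∀ M : Fin n → Fin d → ℝ, (∀ m, M m ∈ simplexFace (B m)) →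
      ∑ m, ∑ a ∈ F m, M m a ≤ ∑ _m : Fin n, (1 : ℝ) := fun M hM =>
    Finset.sum_le_sum fun m _ => sum_le_one_of_mem_simplexFace (hM m)
  refine ⟨l, Set.ext fun x => ⟨fun hx => ?_, fun hx => ?_⟩⟩
  · obtain ⟨M, hM, rfl⟩ := mem_minkowskiSum.1 hx
    have hMB : ∀ m, M m ∈ simplexFace (B m) := fun m => simplexFace_mono (hFB m) (hM m)
    refine ⟨mem_minkowskiSum.2 ⟨M, hMB, rfl⟩, fun y hy => ?_⟩
    obtain ⟨M', hM', rfl⟩ := mem_minkowskiSum.1 hy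
    have h1 := hl M' M hM' hMB
    rw [Finset.sum_congr rfl fun m _ => sum_eq_one_of_mem_simplexFace (hM m)] at h1
    linarith [hle M' hM']
  · obtain ⟨hx, hmax⟩ := hx
    obtain ⟨M, hM, rfl⟩ := mem_minkowskiSum.1 hx
    refine mem_minkowskiSum.2 ⟨M, fun m => ?_, rfl⟩
    set M₀ : Fin n → Fin d → ℝ := fun m => Pi.single (f m) 1 with hM₀
    have hM₀F : ∀ m, M₀ m ∈ simplexFace (F m) := fun m => single_mem_simplexFace (hf m)
    have hM₀B : ∀ m, M₀ m ∈ simplexFace (B m) := fun m => simplexFace_mono (hFB m) (hM₀F m)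
    have h1 := hl M M₀ hM hM₀B
    rw [Finset.sum_congr (s₁ := Finset.univ) (f := fun m => ∑ a ∈ F m, M₀ m a) rfl
      fun m _ => sum_eq_one_of_mem_simplexFace (hM₀F m)] at h1
    have h2 := hmax _ (mem_minkowskiSum.2 ⟨M₀, hM₀B, rfl⟩)
    have h3 : ∑ m, ∑ a ∈ F m, M m a = ∑ _m : Fin n, (1 : ℝ) :=
      le_antisymm (hle M hM) (by linarith)
    exact mem_simplexFace_of_sum_eq_one (hM m) ((Finset.sum_eq_sum_iff_of_le fun m _ =>
      sum_le_one_of_mem_simplexFace (hM m)).1 h3 m (Finset.mem_univ m))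

theorem SumsInjective.subset_of_minkowskiSum_subset {B F F' : Fin n → Finset (Fin d)}
    (hB : SumsInjective B) (hFB : ∀ m, F m ⊆ B m) (hFB' : ∀ m, F' m ⊆ B m)
    (hF : ∀ m, (F m).Nonempty) (h : minkowskiSum F ⊆ minkowskiSum F') (m : Fin n) :
    F m ⊆ F' m := by
  intro a ha
  choose f hf using hF
  set M : Fin n → Fin d → ℝ := fun m' => Pi.single (Function.update f m a m') 1 with hM
  have hMF : ∀ m', M m' ∈ simplexFace (F m') := fun m' => single_mem_simplexFace (by
    rcases eq_or_ne m' m with rfl | h'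
    · simpa using ha
    · simpa [h'] using hf m')
  obtain ⟨M', hM', hs⟩ := mem_minkowskiSum.1 (h (mem_minkowskiSum.2 ⟨M, hMF, rfl⟩))
  have heq := hB.eq_of_sum_eq (fun m => simplexFace_mono (hFB' m) (hM' m))
    (fun m => simplexFace_mono (hFB m) (hMF m)) hs
  by_contra hna
  have h0 := (mem_simplexFace.1 (hM' m)).2.1 a hna
  rw [heq] at h0
  simp [hM] at h0

end Geometry

/-! ### Decompositions across the whole subdivision -/

namespace FineMixedSubdivision.Labelling

variable {n d : ℕ} {S : FineMixedSubdivision n d} (L : S.Labelling)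

/-- The rows of `M` are points of the summands of a cell of the subdivision. -/
def IsDecomposition (M : Fin n → Fin d → ℝ) : Prop :=
  ∃ G ∈ S.faces, ∀ m, M m ∈ simplexFace (L.label G m)

theorem sumsInjective {G : Set (Fin d → ℝ)} (hG : G ∈ S.faces) : SumsInjective (L.label G) :=
  (L.isFine G hG).sumsInjective

theorem exists_cell {G : Set (Fin d → ℝ)} (hG : G ∈ S.faces) :
    ∃ C ∈ S.cells, C ∈ S.faces ∧ ∀ m, L.label G m ⊆ L.label C m := by
  obtain ⟨hne, C, hC, hexp⟩ := id hG
  have hCf : C ∈ S.faces := ⟨hne.mono hexp.subset, C, hC, IsExposed.refl C⟩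
  exact ⟨C, hC, hCf, L.mono G hG C hCf hexp⟩

variable {L} in
-- The point lies in the common face of two full cells. By `L.mono`, a decomposition with respect to
-- the label of that face is valid in both cells, and uniqueness in each cell identifies it with `M`
-- and with `M'`.
theorem IsDecomposition.eq {M M' : Fin n → Fin d → ℝ} (hM : L.IsDecomposition M)
    (hM' : L.IsDecomposition M') (h : ∑ m, M m = ∑ m, M' m) : M = M' := by
  obtain ⟨G, hG, hMG⟩ := hM
  obtain ⟨G', hG', hMG'⟩ := hM'
  obtain ⟨C, hC, hCf, hGC⟩ := L.exists_cell hG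
  obtain ⟨C', hC', hCf', hGC'⟩ := L.exists_cell hG'
  have hMC := fun m => simplexFace_mono (hGC m) (hMG m)
  have hMC' := fun m => simplexFace_mono (hGC' m) (hMG' m)
  have hxC : ∑ m, M m ∈ C := by
    rw [← L.sum_eq C hCf]; exact mem_minkowskiSum.2 ⟨M, hMC, rfl⟩
  have hxC' : ∑ m, M m ∈ C' := by
    rw [← L.sum_eq C' hCf']; exact mem_minkowskiSum.2 ⟨M', hMC', h.symm⟩
  obtain ⟨h1, h2⟩ := S.inter_face C hC C' hC'
  have hF : C ∩ C' ∈ S.faces := ⟨⟨_, hxC, hxC'⟩, C, hC, h1⟩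
  have hx : ∑ m, M m ∈ minkowskiSum (L.label (C ∩ C')) := by
    rw [L.sum_eq _ hF]; exact ⟨hxC, hxC'⟩
  obtain ⟨N, hN, hs⟩ := mem_minkowskiSum.1 hx
  have e1 := (L.sumsInjective hCf).eq_of_sum_eq
    (fun m => simplexFace_mono (L.mono _ hF C hCf h1 m) (hN m)) hMC hs
  have e2 := (L.sumsInjective hCf').eq_of_sum_eq
    (fun m => simplexFace_mono (L.mono _ hF C' hCf' h2 m) (hN m)) hMC' (hs.trans h)
  rw [← e1, e2]

theorem exists_isDecomposition {x : Fin d → ℝ} (hx : 0 ≤ x) (hs : ∑ a, x a = n)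
    (hn : 0 < n) : ∃ M, L.IsDecomposition M ∧ ∑ m, M m = x := by
  have hn' : (n : ℝ) ≠ 0 := by positivity
  have hmem : x ∈ (n : ℝ) • stdSimplex ℝ (Fin d) := by
    refine Set.mem_smul_set.2 ⟨(n : ℝ)⁻¹ • x, ⟨fun a => ?_, ?_⟩, by simp [hn']⟩
    · have := hx a
      simp only [Pi.zero_apply] at this
      simp only [Pi.smul_apply, smul_eq_mul]
      positivity
    · simp [← Finset.mul_sum, hs, hn']
  rw [← S.cover] at hmem
  obtain ⟨C, hC, hxC⟩ := hmem
  have hCf : C ∈ S.faces := ⟨⟨x, hxC⟩, C, hC, IsExposed.refl C⟩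
  rw [← L.sum_eq C hCf] at hxC
  obtain ⟨M, hM, hMx⟩ := mem_minkowskiSum.1 hxC
  exact ⟨M, ⟨C, hCf, hM⟩, hMx⟩

/-- Sums of nonempty subsets of the summands of a cell are cells. -/
theorem exists_face_of_subset {G : Set (Fin d → ℝ)} (hG : G ∈ S.faces)
    {F : Fin n → Finset (Fin d)} (hFG : ∀ m, F m ⊆ L.label G m) (hF : ∀ m, (F m).Nonempty) :
    ∃ H ∈ S.faces, L.label H = F := by
  obtain ⟨C, hC, hCf, hGC⟩ := L.exists_cell hG
  have hFC := fun m => (hFG m).trans (hGC m)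
  have hinj := L.sumsInjective hCf
  have hexp := hinj.isExposed hFC hF
  rw [L.sum_eq C hCf] at hexp
  choose f hf using hF
  have hH : minkowskiSum F ∈ S.faces :=
    ⟨⟨_, mem_minkowskiSum.2 ⟨_, fun m => single_mem_simplexFace (hf m), rfl⟩⟩, C, hC, hexp⟩
  have hHC := L.mono _ hH C hCf hexp
  -- The label of this face is only known to have the same Minkowski sum as `F`; both lie inside the
  -- label of `C`, where the sum determines the summands.
  refine ⟨_, hH, funext fun m => Finset.Subset.antisymm ?_ ?_⟩
  · exact hinj.subset_of_minkowskiSum_subset hHC hFC (L.isFine _ hH).1 (L.sum_eq _ hH).subset m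
  · exact hinj.subset_of_minkowskiSum_subset hFC hHC (fun m => ⟨f m, hf m⟩)
      (L.sum_eq _ hH).superset m

/-- The labels of the cells. -/
def labels : Set (Fin n → Finset (Fin d)) := L.label '' S.faces

theorem sumsInjective_of_mem_labels {B : Fin n → Finset (Fin d)} (hB : B ∈ L.labels) :
    SumsInjective B := by
  obtain ⟨G, hG, rfl⟩ := hB
  exact L.sumsInjective hG

variable {L} in
theorem IsDecomposition.sum_row {M : Fin n → Fin d → ℝ} (hM : L.IsDecomposition M) (m : Fin n) :
    ∑ a, M m a = 1 := by
  obtain ⟨G, -, hM⟩ := hM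
  exact (mem_simplexFace.1 (hM m)).2.2

variable {L} in
theorem IsDecomposition.nonneg {M : Fin n → Fin d → ℝ} (hM : L.IsDecomposition M) (m : Fin n)
    (a : Fin d) : 0 ≤ M m a := by
  obtain ⟨G, -, hM⟩ := hM
  exact (mem_simplexFace.1 (hM m)).1 a

variable {L} in
theorem IsDecomposition.smul_mem_matrixCone {M : Fin n → Fin d → ℝ} (hM : L.IsDecomposition M)
    {t : ℝ} (ht : 0 ≤ t) : ∃ B ∈ L.labels, t • M ∈ matrixCone B := by
  have hrow := hM.sum_row
  obtain ⟨G, hG, hM⟩ := hM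
  refine ⟨_, ⟨G, hG, rfl⟩, fun m a => ?_, fun m a ha => ?_, fun m m' => ?_⟩
  · exact mul_nonneg ht ((mem_simplexFace.1 (hM m)).1 a)
  · simp [(mem_simplexFace.1 (hM m)).2.1 a ha]
  · simp [← Finset.mul_sum, hrow]

theorem isDecomposition_of_mem_matrixCone {N : Fin n → Fin d → ℝ} {B : Fin n → Finset (Fin d)}
    (hB : B ∈ L.labels) (hN : N ∈ matrixCone B) {t : ℝ} (ht : 0 < t) (hrow : ∀ m, ∑ a, N m a = t) :
    L.IsDecomposition (t⁻¹ • N) := by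
  obtain ⟨G, hG, rfl⟩ := hB
  refine ⟨G, hG, fun m => mem_simplexFace.2 ⟨fun a => ?_, fun a ha => ?_, ?_⟩⟩
  · exact mul_nonneg (inv_nonneg.2 ht.le) (hN.1 m a)
  · simp [hN.2.1 m a ha]
  · simp [← Finset.mul_sum, hrow, ht.ne']

/-- Existence and uniqueness of decompositions, extended homogeneously from `nΔ` to the orthant;
this starts the continuation at `c = 0`. -/
theorem exists_isInverse (hn : 0 < n) (hd : 0 < d) (I : Finset (Fin n)) :
    ∃ J, IsInverse L.labels I 0 J := by
  have hn' : (0 : ℝ) < n := by positivity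
  have hw : ∀ N : Fin n → Fin d → ℝ, weightedSum I 0 N = ∑ m, N m := fun N => by
    simp [weightedSum]
  have hex : ∀ z : Fin d → ℝ, 0 ≤ z →
      ∃ N : Fin n → Fin d → ℝ, (∃ B ∈ L.labels, N ∈ matrixCone B) ∧ ∑ m, N m = z := by
    intro z hz
    have ht : 0 ≤ (∑ a, z a) / n := div_nonneg (Finset.sum_nonneg fun a _ => hz a) hn'.le
    rcases ht.eq_or_lt with ht0 | ht0
    · have hsum : ∑ a, z a = 0 := by
        rw [eq_comm, div_eq_zero_iff] at ht0
        exact ht0.resolve_right hn'.ne'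
      have hz0 : z = 0 := funext fun a =>
        (Finset.sum_eq_zero_iff_of_nonneg fun a _ => hz a).1 hsum a (Finset.mem_univ a)
      -- At `z = 0` the matrix is zero, but some label is needed to hold it; decomposing any point
      -- of `nΔ` supplies one.
      obtain ⟨M, hM, -⟩ := L.exists_isDecomposition (x := Pi.single ⟨0, hd⟩ (n : ℝ))
        (Pi.single_nonneg.2 hn'.le) (by simp) hn
      obtain ⟨B, hB, hMB⟩ := hM.smul_mem_matrixCone (le_refl (0 : ℝ))
      exact ⟨0 • M, ⟨B, hB, by simpa using hMB⟩, by simp [hz0]⟩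
    · set t := (∑ a, z a) / n with htdef
      obtain ⟨M, hM, hMs⟩ := L.exists_isDecomposition (x := t⁻¹ • z)
        (smul_nonneg (inv_nonneg.2 ht0.le) hz) (by
          simp only [Pi.smul_apply, smul_eq_mul, ← Finset.mul_sum]
          rw [inv_mul_eq_iff_eq_mul₀ ht0.ne', htdef, div_mul_cancel₀ _ hn'.ne']) hn
      refine ⟨t • M, hM.smul_mem_matrixCone ht0.le, ?_⟩
      simp only [Pi.smul_apply, ← Finset.smul_sum, hMs, smul_inv_smul₀ ht0.ne']
  have huniq : ∀ N N' : Fin n → Fin d → ℝ, (∃ B ∈ L.labels, N ∈ matrixCone B) →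
      (∃ B ∈ L.labels, N' ∈ matrixCone B) → ∑ m, N m = ∑ m, N' m → N = N' := by
    rintro N N' ⟨B, hB, hN⟩ ⟨B', hB', hN'⟩ h
    let m₀ : Fin n := ⟨0, hn⟩
    have e := sum_weightedSum hN I 0 m₀
    have e' := sum_weightedSum hN' I 0 m₀
    rw [hw] at e e'
    rw [h, e', mul_eq_mul_left_iff] at e
    have hne : (n : ℝ) + 0 * I.card ≠ 0 := by simpa using hn'.ne'
    have e := e.resolve_right hne
    set t := ∑ a, N m₀ a with ht
    have hrow : ∀ m, ∑ a, N m a = t := fun m => hN.2.2 m m₀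
    have hrow' : ∀ m, ∑ a, N' m a = t := fun m => (hN'.2.2 m m₀).trans e
    have ht0 : 0 ≤ t := Finset.sum_nonneg fun a _ => hN.1 m₀ a
    rcases ht0.eq_or_lt with ht0 | ht0
    · have hz : ∀ {B : Fin n → Finset (Fin d)} {N : Fin n → Fin d → ℝ}, N ∈ matrixCone B →
          (∀ m, ∑ a, N m a = t) → N = 0 := fun hN hrow => funext fun m => funext fun a =>
        (Finset.sum_eq_zero_iff_of_nonneg fun a _ => hN.1 m a).1 ((hrow m).trans ht0.symm) a
          (Finset.mem_univ a)
      rw [hz hN hrow, hz hN' hrow']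
    · have := (L.isDecomposition_of_mem_matrixCone hB hN ht0 hrow).eq
        (L.isDecomposition_of_mem_matrixCone hB' hN' ht0 hrow')
        (by simp only [Pi.smul_apply, ← Finset.smul_sum, h])
      exact smul_right_injective _ (inv_ne_zero ht0.ne') this
  choose! J hJ hJs using hex
  refine ⟨J, fun z hz => ⟨hJ z hz, by rw [hw, hJs z hz]⟩, fun B hB N hN => ?_⟩
  have h0 : 0 ≤ weightedSum I 0 N := weightedSum_nonneg le_rfl hN
  exact huniq _ _ (hJ _ h0) ⟨B, hB, hN⟩ (by rw [hJs _ h0, hw])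

variable {L} in
theorem IsDecomposition.false_of_exchange {M M' : Fin n → Fin d → ℝ} (hM : L.IsDecomposition M)
    (hM' : L.IsDecomposition M') {i j : Fin n} (hij : i ≠ j) {a b : Fin d} (hab : a ≠ b)
    (hi : M i = Pi.single b 1) (hj : M j = Pi.single a 1) (hi' : M' i = Pi.single a 1)
    (hj' : M' j = Pi.single b 1) : False := by
  have hn : 0 < n := i.pos
  obtain ⟨J, hJ⟩ := L.exists_isInverse hn a.pos {i, j}
  refine not_exchange hn (fun B hB => L.sumsInjective_of_mem_labels hB) hij hJ ?_ ?_ hM.sum_row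
    hM'.sum_row hab hi hj hi' hj'
  · simpa using hM.smul_mem_matrixCone zero_le_one
  · simpa using hM'.smul_mem_matrixCone zero_le_one

/-- For every face `A` of the simplex and every `i` there is a cell all of whose summands meet `A`
and whose `i`-th summand contains `A`. -/
theorem exists_face_superset (i : Fin n) {A : Finset (Fin d)} (hA : A.Nonempty) :
    ∃ G ∈ S.faces, A ⊆ L.label G i ∧ ∀ m, ∃ x ∈ A, x ∈ L.label G m := by
  have hn : 0 < n := i.pos
  obtain ⟨a₀, ha₀⟩ := id hA
  obtain ⟨J, hJ⟩ := L.exists_isInverse hn a₀.pos {i}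
  have hc : (0 : ℝ) < A.card := by exact_mod_cast hA.card_pos
  -- Row `i` is the barycentre of `A`, so its support is all of `A`; the other rows are supported in
  -- `A` as well.
  obtain ⟨N, hsupp, ⟨B, hB, hN⟩, hrow, hs⟩ := exists_partial_sum_eq hn
    (fun B hB => L.sumsInjective_of_mem_labels hB) (Finset.singleton_nonempty i) hJ
    (y := fun a => if a ∈ A then (A.card : ℝ)⁻¹ else 0)
    (fun a => by simp only [Pi.zero_apply]; split_ifs <;> positivity)
    (by simp [hc.ne'])
  obtain ⟨G, hG, rfl⟩ := hB
  refine ⟨G, hG, fun a ha => ?_, fun m => ?_⟩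
  · by_contra h
    have := congrFun hs a
    simp only [Finset.sum_singleton, hN.2.1 i a h, ha, if_true] at this
    exact (inv_pos.2 hc).ne this
  · obtain ⟨x, -, hx⟩ := Finset.exists_ne_zero_of_sum_ne_zero
      (s := Finset.univ) (f := N m) (by rw [hrow m]; exact one_ne_zero)
    refine ⟨x, ?_, ?_⟩
    · by_contra h
      exact hx (hsupp m x (by simp [h]))
    · by_contra h
      exact hx (hN.2.1 m x h)

end FineMixedSubdivision.Labelling

end FineMixed

namespace FineMixed

/-! ### Combinatorics of edge cells -/

section Edges

variable {n d : ℕ}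

/-- The summands of an edge cell: `w_a w_b` in position `m`, `w_b` in the positions in `J` and
`w_a` elsewhere. -/
def edgeLabel (a b : Fin d) (m : Fin n) (J : Finset (Fin n)) : Fin n → Finset (Fin d) :=
  fun i => if i = m then {a, b} else if i ∈ J then {b} else {a}

/-- The matrix whose `i`-th row is the point of `w_a w_b` with parameter `u i`. -/
def edgeMatrix (a b : Fin d) (u : Fin n → ℝ) : Fin n → Fin d → ℝ :=
  fun i => (1 - u i) • Pi.single a 1 + u i • Pi.single b 1

/-- The indicator function of a set of positions. -/
def indicatorVec (J : Finset (Fin n)) : Fin n → ℝ := fun i => if i ∈ J then 1 else 0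

theorem pair_ne_singleton {a b : Fin d} (hab : a ≠ b) (c : Fin d) :
    ({a, b} : Finset (Fin d)) ≠ {c} := fun h => by
  have := congrArg Finset.card h
  rw [Finset.card_pair hab, Finset.card_singleton] at this
  omega

/-- The two counts and the position `m` exhaust all `n` positions, so no other summand can occur. -/
theorem isEdgeCell_iff {a b : Fin d} (hab : a ≠ b) {k : ℕ} {m : Fin n}
    {B : Fin n → Finset (Fin d)} :
    IsEdgeCell a b k m B ↔ ∃ J : Finset (Fin n), J.card = k ∧ m ∉ J ∧ B = edgeLabel a b m J := by
  constructor
  · rintro ⟨h1, h2, h3⟩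
    refine ⟨Finset.univ.filter fun i => B i = {b}, h1, by simp [h3, pair_ne_singleton hab], ?_⟩
    have hdisj : Disjoint (Finset.univ.filter fun i => B i = {b})
        (Finset.univ.filter fun i => B i = {a}) := by
      refine Finset.disjoint_filter.2 fun i _ hb ha => hab ?_
      exact (Finset.singleton_injective (hb.symm.trans ha)).symm
    have hm : m ∉ (Finset.univ.filter fun i => B i = {b}) ∪
        (Finset.univ.filter fun i => B i = {a}) := by
      simp [h3, pair_ne_singleton hab]
    have hcard := Finset.card_insert_of_notMem hm
    rw [Finset.card_union_of_disjoint hdisj] at hcard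
    have huniv := Finset.eq_univ_of_card _
      (hcard.trans (by rw [Fintype.card_fin]; omega) : _ = Fintype.card (Fin n))
    funext i
    have hi := Finset.mem_univ i
    rw [← huniv] at hi
    simp only [Finset.mem_insert, Finset.mem_union, Finset.mem_filter, Finset.mem_univ,
      true_and] at hi
    simp only [edgeLabel, Finset.mem_filter, Finset.mem_univ, true_and]
    split_ifs with h h'
    · rw [h, h3]
    · exact h'
    · tauto
  · rintro ⟨J, rfl, hm, rfl⟩
    have hb : (Finset.univ.filter fun i => edgeLabel a b m J i = {b}) = J := by
      ext i
      simp only [Finset.mem_filter, Finset.mem_univ, true_and]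
      unfold edgeLabel
      split_ifs with h h'
      · simp [h, hm, pair_ne_singleton hab]
      · simp [h']
      · simp [h', hab]
    have ha : (Finset.univ.filter fun i => edgeLabel a b m J i = {a}) = (insert m J)ᶜ := by
      ext i
      simp only [Finset.mem_filter, Finset.mem_univ, true_and, Finset.mem_compl,
        Finset.mem_insert, not_or]
      unfold edgeLabel
      split_ifs with h h'
      · simp [h, pair_ne_singleton hab]
      · simp [h', hab.symm]
      · simp [h, h']
    refine ⟨by rw [hb], ?_, by simp [edgeLabel]⟩
    rw [ha, Finset.card_compl, Fintype.card_fin, Finset.card_insert_of_notMem hm]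
    have := (insert m J).card_le_univ
    rw [Finset.card_insert_of_notMem hm, Fintype.card_fin] at this
    omega

theorem isEdgeCell_swap {a b : Fin d} {k l : ℕ} {m : Fin n} {B : Fin n → Finset (Fin d)}
    (hkl : k + l + 1 = n) (h : IsEdgeCell b a k m B) : IsEdgeCell a b l m B := by
  obtain ⟨h1, h2, h3⟩ := h
  exact ⟨by omega, by omega, by rw [h3, Finset.pair_comm]⟩

theorem sum_edgeMatrix (a b : Fin d) (u : Fin n → ℝ) :
    ∑ i, edgeMatrix a b u i =
      ((n : ℝ) - ∑ i, u i) • Pi.single a 1 + (∑ i, u i) • (Pi.single b 1 : Fin d → ℝ) := by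
  simp only [edgeMatrix, Finset.sum_add_distrib, ← Finset.sum_smul, Finset.sum_sub_distrib]
  simp

theorem edgeMatrix_injective {a b : Fin d} (hab : a ≠ b) :
    Function.Injective (edgeMatrix a b : (Fin n → ℝ) → Fin n → Fin d → ℝ) := fun u v h => by
  funext i
  have := congrFun (congrFun h i) b
  simpa [edgeMatrix, hab.symm] using this

theorem edgeMatrix_mem_simplexFace {a b : Fin d} {u : Fin n → ℝ} {i : Fin n}
    {A : Finset (Fin d)} (h0 : 0 ≤ u i) (h1 : u i ≤ 1) (ha : u i ≠ 1 → a ∈ A)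
    (hb : u i ≠ 0 → b ∈ A) : edgeMatrix a b u i ∈ simplexFace A := by
  unfold edgeMatrix
  rcases eq_or_ne (u i) 0 with h | h
  · rw [h]; simpa using single_mem_simplexFace (ha (by rw [h]; exact zero_ne_one))
  rcases eq_or_ne (u i) 1 with h' | h'
  · rw [h']; simpa using single_mem_simplexFace (hb h)
  · exact convex_convexHull ℝ _ (single_mem_simplexFace (ha h')) (single_mem_simplexFace (hb h))
      (by linarith) h0 (by ring)

theorem sum_indicatorVec (J : Finset (Fin n)) : ∑ i, indicatorVec J i = J.card := by
  simp [indicatorVec]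

theorem indicatorVec_injective :
    Function.Injective (indicatorVec : Finset (Fin n) → Fin n → ℝ) := fun J J' h => by
  ext i
  have := congrFun h i
  by_cases h1 : i ∈ J <;> by_cases h2 : i ∈ J' <;> simp_all [indicatorVec]

theorem edgeMatrix_indicatorVec_of_mem (a b : Fin d) {J : Finset (Fin n)} {i : Fin n}
    (h : i ∈ J) : edgeMatrix a b (indicatorVec J) i = Pi.single b 1 := by
  simp [edgeMatrix, indicatorVec, h]

theorem edgeMatrix_indicatorVec_of_notMem (a b : Fin d) {J : Finset (Fin n)} {i : Fin n}
    (h : i ∉ J) : edgeMatrix a b (indicatorVec J) i = Pi.single a 1 := by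
  simp [edgeMatrix, indicatorVec, h]

/-- The parameters of the midpoint of an edge cell. -/
noncomputable def midpointVec (m : Fin n) (J : Finset (Fin n)) : Fin n → ℝ :=
  fun i => (if i = m then 1 / 2 else 0) + indicatorVec J i

theorem sum_midpointVec (m : Fin n) (J : Finset (Fin n)) :
    ∑ i, midpointVec m J i = 1 / 2 + J.card := by
  simp [midpointVec, Finset.sum_add_distrib, sum_indicatorVec]

theorem midpointVec_eq_half_iff {m : Fin n} {J : Finset (Fin n)} (hm : m ∉ J) {i : Fin n} :
    midpointVec m J i = 1 / 2 ↔ i = m := by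
  rcases eq_or_ne i m with rfl | h
  · simp [midpointVec, indicatorVec, hm]
  · by_cases h' : i ∈ J <;> simp [midpointVec, indicatorVec, h, h']

theorem midpointVec_eq_one_iff {m : Fin n} {J : Finset (Fin n)} (hm : m ∉ J) {i : Fin n} :
    midpointVec m J i = 1 ↔ i ∈ J := by
  rcases eq_or_ne i m with rfl | h
  · simp [midpointVec, indicatorVec, hm]
  · by_cases h' : i ∈ J <;> simp [midpointVec, indicatorVec, h, h']

theorem midpointVec_injective {m m' : Fin n} {J J' : Finset (Fin n)} (hm : m ∉ J) (hm' : m' ∉ J')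
    (h : midpointVec m J = midpointVec m' J') : m = m' ∧ J = J' := by
  constructor
  · rw [← midpointVec_eq_half_iff hm', ← h, midpointVec_eq_half_iff hm]
  · ext i
    rw [← midpointVec_eq_one_iff hm, h, midpointVec_eq_one_iff hm']

end Edges

/-! ### The permutations on the edges and their acyclicity -/

namespace FineMixedSubdivision.Labelling

variable {n d : ℕ} {S : FineMixedSubdivision n d} (L : S.Labelling)

/-- The sum of `w_a w_b` in position `m`, `w_b` in the positions in `J` and `w_a` elsewhere is a
cell. -/
def HasEdge (a b : Fin d) (m : Fin n) (J : Finset (Fin n)) : Prop :=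
  m ∉ J ∧ ∃ G ∈ S.faces, L.label G = edgeLabel a b m J

variable {L} {a b : Fin d} {m m' : Fin n} {J J' : Finset (Fin n)}

theorem HasEdge.isDecomposition_midpoint (h : L.HasEdge a b m J) :
    L.IsDecomposition (edgeMatrix a b (midpointVec m J)) := by
  obtain ⟨hm, G, hG, hl⟩ := h
  refine ⟨G, hG, fun i => ?_⟩
  rw [hl]
  rcases eq_or_ne i m with rfl | hi
  · have : midpointVec i J i = 1 / 2 := (midpointVec_eq_half_iff hm).2 rfl
    refine edgeMatrix_mem_simplexFace ?_ ?_ ?_ ?_ <;> rw [this] <;>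
      norm_num [edgeLabel]
  · by_cases hJ : i ∈ J <;> refine edgeMatrix_mem_simplexFace ?_ ?_ ?_ ?_ <;>
      simp [midpointVec, indicatorVec, edgeLabel, hi, hJ]

theorem HasEdge.isDecomposition_left (h : L.HasEdge a b m J) :
    L.IsDecomposition (edgeMatrix a b (indicatorVec J)) := by
  obtain ⟨hm, G, hG, hl⟩ := h
  refine ⟨G, hG, fun i => ?_⟩
  rw [hl]
  by_cases hJ : i ∈ J
  · rw [edgeMatrix_indicatorVec_of_mem a b hJ]
    exact single_mem_simplexFace (by simp only [edgeLabel]; split_ifs <;> simp)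
  · rw [edgeMatrix_indicatorVec_of_notMem a b hJ]
    exact single_mem_simplexFace (by simp only [edgeLabel]; split_ifs <;> simp)

theorem HasEdge.isDecomposition_right (h : L.HasEdge a b m J) :
    L.IsDecomposition (edgeMatrix a b (indicatorVec (insert m J))) := by
  obtain ⟨hm, G, hG, hl⟩ := h
  refine ⟨G, hG, fun i => ?_⟩
  rw [hl]
  by_cases hJ : i ∈ insert m J
  · rw [edgeMatrix_indicatorVec_of_mem a b hJ]
    rw [Finset.mem_insert] at hJ
    exact single_mem_simplexFace (by
      simp only [edgeLabel]
      split_ifs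
      · simp
      · simp
      · tauto)
  · rw [edgeMatrix_indicatorVec_of_notMem a b hJ]
    rw [Finset.mem_insert, not_or] at hJ
    exact single_mem_simplexFace (by simp [edgeLabel, hJ])

/-- Two such cells have the same midpoint, whose decomposition determines `m` (the entry `1/2`) and
`J` (the entries `1`). -/
theorem HasEdge.unique (hab : a ≠ b) (h : L.HasEdge a b m J) (h' : L.HasEdge a b m' J')
    (hJ : J.card = J'.card) : m = m' ∧ J = J' := by
  have heq := h.isDecomposition_midpoint.eq h'.isDecomposition_midpoint (by
    simp only [sum_edgeMatrix, sum_midpointVec, hJ])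
  exact midpointVec_injective h.1 h'.1 (edgeMatrix_injective hab heq)

/-- The `w_b`-end of one edge cell is the `w_a`-end of the next. -/
theorem HasEdge.insert_eq (hab : a ≠ b) (h : L.HasEdge a b m J) (h' : L.HasEdge a b m' J')
    (hJ : J.card + 1 = J'.card) : insert m J = J' := by
  have heq := h.isDecomposition_right.eq h'.isDecomposition_left (by
    simp only [sum_edgeMatrix, sum_indicatorVec, Finset.card_insert_of_notMem h.1, hJ])
  exact indicatorVec_injective (edgeMatrix_injective hab heq)

variable (L) in
theorem exists_hasEdge (hab : a ≠ b) {k : ℕ} (hk : k < n) :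
    ∃ m J, J.card = k ∧ L.HasEdge a b m J := by
  have hkn : (k : ℝ) + 1 ≤ n := by exact_mod_cast hk
  have hk0 : (0 : ℝ) ≤ k := by positivity
  set x : Fin d → ℝ :=
    ((n : ℝ) - (k + 1 / 2)) • Pi.single a 1 + ((k : ℝ) + 1 / 2) • Pi.single b 1 with hx
  have hxa : ∀ c, c ≠ a → c ≠ b → x c = 0 := fun c ha hb => by simp [hx, ha, hb]
  have hxb : x b = k + 1 / 2 := by simp [hx, hab.symm]
  have hx0 : 0 ≤ x := by
    refine add_nonneg (smul_nonneg (by linarith) (Pi.single_nonneg.2 zero_le_one))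
      (smul_nonneg (by linarith) (Pi.single_nonneg.2 zero_le_one))
  obtain ⟨M, hM, hMx⟩ := L.exists_isDecomposition hx0
    (by simp [hx, Finset.sum_add_distrib, ← Finset.mul_sum]) (by omega)
  have hMc : ∀ i c, c ≠ a → c ≠ b → M i c = 0 := fun i c ha hb => by
    have := congrFun hMx c
    rw [hxa c ha hb, Finset.sum_apply] at this
    exact (Finset.sum_eq_zero_iff_of_nonneg fun i _ => hM.nonneg i c).1 this i (Finset.mem_univ i)
  have hMa : ∀ i, M i a = 1 - M i b := fun i => by
    have := hM.sum_row i
    rw [← Finset.sum_subset (Finset.subset_univ {a, b}) (fun e _ he => by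
      simp only [Finset.mem_insert, Finset.mem_singleton, not_or] at he
      exact hMc i e he.1 he.2), Finset.sum_pair hab] at this
    linarith
  have hMsum : ∑ i, M i b = k + 1 / 2 := by
    rw [← hxb, ← hMx, Finset.sum_apply]
  obtain ⟨G, hG, hMG⟩ := id hM
  have hmem : ∀ i c, M i c ≠ 0 → c ∈ L.label G i := fun i c h => by
    by_contra h'
    exact h ((mem_simplexFace.1 (hMG i)).2.1 c h')
  have hamem : ∀ i, M i b ≠ 1 → a ∈ L.label G i := fun i h =>
    hmem i a (by rw [hMa]; exact sub_ne_zero.2 h.symm)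
  set J := Finset.univ.filter fun i => M i b = 1 with hJ
  -- If all entries were `0` or `1`, their sum `k + 1/2` would be an integer.
  obtain ⟨m, hm⟩ : ∃ m, M m b ≠ 0 ∧ M m b ≠ 1 := by
    by_contra! h
    have h1 : ∑ i, M i b = J.card := by
      rw [← sum_indicatorVec]
      refine Finset.sum_congr rfl fun i _ => ?_
      by_cases hi : M i b = 0
      · simp [indicatorVec, hJ, hi]
      · simp [indicatorVec, hJ, h i hi]
    rw [hMsum] at h1
    have h2 : (2 * k + 1 : ℝ) = 2 * J.card := by linarith
    have h3 : 2 * k + 1 = 2 * J.card := by exact_mod_cast h2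
    omega
  -- Two strictly mixed rows would give two summands of `G` sharing both `a` and `b`.
  have hother : ∀ i, i ≠ m → M i b = 0 ∨ M i b = 1 := fun i hi => by
    by_contra! h
    exact (L.sumsInjective hG).false_of_shared_pair hi hab (hamem i h.2) (hmem i b h.1)
      (hamem m hm.2) (hmem m b hm.1)
  have hmJ : m ∉ J := by simp [hJ, hm.2]
  refine ⟨m, J, ?_, hmJ, L.exists_face_of_subset hG (fun i => ?_) fun i => ?_⟩
  · have h1 : ∑ i, M i b = M m b + J.card := by
      have h2 : ∀ i, M i b = (if i = m then M m b else 0) + indicatorVec J i := fun i => by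
        rcases eq_or_ne i m with rfl | hi
        · simp [indicatorVec, hmJ]
        · rcases hother i hi with h | h <;> simp [indicatorVec, hJ, hi, h]
      rw [Finset.sum_congr rfl fun i _ => h2 i, Finset.sum_add_distrib, sum_indicatorVec]
      simp
    have h2 : M m b < 1 := lt_of_le_of_ne (by linarith [hMa m, hM.nonneg m a]) hm.2
    have h3 : 0 < M m b := lt_of_le_of_ne (hM.nonneg m b) hm.1.symm
    have h4 : (J.card : ℝ) < k + 1 := by linarith
    have h5 : (k : ℝ) < J.card + 1 := by linarith
    have h4' : J.card < k + 1 := by exact_mod_cast h4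
    have h5' : k < J.card + 1 := by exact_mod_cast h5
    omega
  · intro c hc
    simp only [edgeLabel] at hc
    split_ifs at hc with h h'
    · subst h
      rcases Finset.mem_insert.1 hc with rfl | hc
      · exact hamem i hm.2
      · rw [Finset.mem_singleton.1 hc]; exact hmem i b hm.1
    · rw [Finset.mem_singleton.1 hc]
      refine hmem i b ?_
      rw [(Finset.mem_filter.1 h').2]; exact one_ne_zero
    · rw [Finset.mem_singleton.1 hc]
      exact hamem i fun h1 => h' (Finset.mem_filter.2 ⟨Finset.mem_univ i, h1⟩)
  · simp only [edgeLabel]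
    split_ifs <;> simp

theorem HasEdge.insert_subset (hab : a ≠ b) (h : L.HasEdge a b m J) (h' : L.HasEdge a b m' J')
    (hJ : J.card < J'.card) : insert m J ⊆ J' := by
  obtain ⟨l, hl⟩ : ∃ l, J'.card = l := ⟨_, rfl⟩
  rw [hl] at hJ
  induction l, hJ using Nat.le_induction generalizing m' J' with
  | base => exact (h.insert_eq hab h' (by omega)).subset
  | succ l hkl ih =>
    have hln : l < n := by
      have := J'.card_le_univ
      rw [Fintype.card_fin] at this
      omega
    obtain ⟨m₁, J₁, hJ₁, h₁⟩ := L.exists_hasEdge hab hln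
    have e := h₁.insert_eq hab h' (by omega)
    exact (ih h₁ hJ₁).trans ((Finset.subset_insert _ _).trans e.subset)

theorem hasEdge_of_isEdgeCell (hab : a ≠ b) {k : ℕ} {G : Set (Fin d → ℝ)} (hG : G ∈ S.faces)
    (h : IsEdgeCell a b k m (L.label G)) :
    ∃ J, J.card = k ∧ L.HasEdge a b m J ∧ L.label G = edgeLabel a b m J := by
  obtain ⟨J, hJ, hm, hl⟩ := (isEdgeCell_iff hab).1 h
  exact ⟨J, hJ, ⟨hm, G, hG, hl⟩, hl⟩

theorem isEdgeCell_unique (hab : a ≠ b) {k : ℕ} {G G' : Set (Fin d → ℝ)} (hG : G ∈ S.faces)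
    (hG' : G' ∈ S.faces) (h : IsEdgeCell a b k m (L.label G))
    (h' : IsEdgeCell a b k m' (L.label G')) : G = G' ∧ m = m' := by
  obtain ⟨J, hJ, he, hl⟩ := hasEdge_of_isEdgeCell hab hG h
  obtain ⟨J', hJ', he', hl'⟩ := hasEdge_of_isEdgeCell hab hG' h'
  obtain ⟨rfl, rfl⟩ := he.unique hab he' (hJ.trans hJ'.symm)
  exact ⟨by rw [← L.sum_eq G hG, ← L.sum_eq G' hG', hl, hl'], rfl⟩

variable (L) in
theorem exists_isEdgeCell (hab : a ≠ b) (k : Fin n) :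
    ∃ m, ∃ G ∈ S.faces, IsEdgeCell a b k m (L.label G) := by
  obtain ⟨m, J, hJ, hm, G, hG, hl⟩ := L.exists_hasEdge hab k.2
  exact ⟨m, G, hG, (isEdgeCell_iff hab).2 ⟨J, hJ, hm, hl⟩⟩

variable (L) in
theorem exists_isSystem : ∃ σ : SystemOfPermutations n d, L.IsSystem σ := by
  choose p hp using fun (a b : Fin d) (hab : a ≠ b) => L.exists_isEdgeCell hab
  -- Once a row has moved to `w_b` it stays in every later set `J`, whereas the letter at a position
  -- lies outside its own `J`.
  have hinj : ∀ a b hab, Function.Injective (p a b hab) := by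
    intro a b hab k l hkl
    by_contra hne
    wlog hlt : k < l generalizing k l
    · exact this hkl.symm (Ne.symm hne) (lt_of_le_of_ne (not_lt.1 hlt) (Ne.symm hne))
    obtain ⟨G, hG, h⟩ := hp a b hab k
    obtain ⟨G', hG', h'⟩ := hp a b hab l
    obtain ⟨J, hJ, he, -⟩ := hasEdge_of_isEdgeCell hab hG h
    obtain ⟨J', hJ', he', -⟩ := hasEdge_of_isEdgeCell hab hG' h'
    have hsub := he.insert_subset hab he' (by rw [hJ, hJ']; exact hlt)
    exact he'.1 (hkl ▸ hsub (Finset.mem_insert_self _ _))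
  refine ⟨⟨fun a b hab => Equiv.ofBijective (p a b hab)
    (Finite.injective_iff_bijective.1 (hinj a b hab)), fun a b hab k => ?_⟩, fun a b hab k => ?_⟩
  · obtain ⟨G, hG, h⟩ := hp b a hab.symm k
    obtain ⟨G', hG', h'⟩ := hp a b hab k.rev
    -- Traversed backwards, the same cell has its `w_a` and `w_b` counts exchanged, so position `k`
    -- becomes `k.rev`.
    refine (isEdgeCell_unique hab hG hG' (isEdgeCell_swap ?_ h) h').2
    rw [Fin.val_rev]
    omega
  · obtain ⟨G, hG, h⟩ := hp a b hab k
    exact ⟨G, hG, h, fun G' hG' m h' => (isEdgeCell_unique hab hG' hG h' h).1⟩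

theorem IsSystem.eq {σ τ : SystemOfPermutations n d} (hσ : L.IsSystem σ) (hτ : L.IsSystem τ) :
    σ = τ := by
  have h : σ.perm = τ.perm := by
    funext a b hab
    ext1 k
    obtain ⟨F, hF, h, -⟩ := hσ a b hab k
    obtain ⟨F', hF', h', -⟩ := hτ a b hab k
    exact (isEdgeCell_unique hab hF hF' h h').2
  cases σ
  cases τ
  congr

/-- An arc from `a` to `b` in the graph of `i` and `j` yields a vertex of the subdivision whose
`i`-th summand is `w_b` and whose `j`-th summand is `w_a`. -/
theorem IsSystem.exists_isDecomposition_of_arc {σ : SystemOfPermutations n d} (hσ : L.IsSystem σ)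
    {i j : Fin n} (h : σ.arc i j a b) :
    a ≠ b ∧ ∃ M, L.IsDecomposition M ∧ M i = Pi.single b 1 ∧ M j = Pi.single a 1 := by
  obtain ⟨hab, hlt⟩ := h
  obtain ⟨G, hG, h, -⟩ := hσ a b hab ((σ.perm a b hab).symm i)
  obtain ⟨G', hG', h', -⟩ := hσ a b hab ((σ.perm a b hab).symm j)
  rw [Equiv.apply_symm_apply] at h h'
  obtain ⟨J, hJ, he, -⟩ := hasEdge_of_isEdgeCell hab hG h
  obtain ⟨J', hJ', he', -⟩ := hasEdge_of_isEdgeCell hab hG' h'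
  have hsub := he.insert_subset hab he' (by rw [hJ, hJ']; exact hlt)
  -- The vertex just before `j` moves: `i` came earlier and is already at `w_b`, while `j` is still
  -- at `w_a`.
  exact ⟨hab, _, he'.isDecomposition_left,
    edgeMatrix_indicatorVec_of_mem a b (hsub (Finset.mem_insert_self _ _)),
    edgeMatrix_indicatorVec_of_notMem a b he'.1⟩

theorem IsSystem.acyclic {σ : SystemOfPermutations n d} (hσ : L.IsSystem σ) : σ.Acyclic := by
  classical
  intro i j hij a ha
  -- The strongly connected component of `a`. The whole component is needed so that whichever `x ∈
  -- A` the `j`-th summand contains has a predecessor in `A`.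
  set A : Finset (Fin d) := Finset.univ.filter fun p =>
    Relation.TransGen (σ.arc i j) a p ∧ Relation.TransGen (σ.arc i j) p a with hA
  obtain ⟨G, hG, hAG, hmeet⟩ := L.exists_face_superset i (A := A) ⟨a, by simp [hA, ha]⟩
  obtain ⟨x, hxA, hxG⟩ := hmeet j
  obtain ⟨-, hax, hxa⟩ := Finset.mem_filter.1 hxA
  obtain ⟨q, haq, hqx⟩ : ∃ q, Relation.TransGen (σ.arc i j) a q ∧ σ.arc i j q x := by
    cases hax with
    | single h => exact ⟨a, ha, h⟩
    | tail h h' => exact ⟨_, h, h'⟩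
  have hqA : q ∈ A := Finset.mem_filter.2 ⟨Finset.mem_univ q, haq, hxa.head hqx⟩
  obtain ⟨hne, M, hM, hMi, hMj⟩ := hσ.exists_isDecomposition_of_arc hqx
  choose f hf using (L.isFine G hG).1
  -- A vertex of `G` with row `i` at `q` and row `j` at `x`, the exchange of the vertex `M` given by
  -- the arc `q → x`.
  set v : Fin n → Fin d := fun m => if m = i then q else if m = j then x else f m with hv
  have hM' : L.IsDecomposition fun m => Pi.single (v m) 1 := by
    refine ⟨G, hG, fun m => single_mem_simplexFace ?_⟩
    simp only [hv]
    split_ifs with h h'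
    · rw [h]; exact hAG hqA
    · rw [h']; exact hxG
    · exact hf m
  exact hM.false_of_exchange hM' hij hne hMi hMj (by simp [hv]) (by simp [hv, hij.symm])

end FineMixedSubdivision.Labelling

end FineMixed

theorem mainTheorem6 (n d : ℕ) (S : FineMixed.FineMixedSubdivision n d) (L : S.Labelling) :
    (∃! σ : FineMixed.SystemOfPermutations n d, L.IsSystem σ) ∧
      ∀ σ : FineMixed.SystemOfPermutations n d, L.IsSystem σ → σ.Acyclic := by
  obtain ⟨σ, hσ⟩ := L.exists_isSystem
  exact ⟨⟨σ, hσ, fun τ hτ => hτ.eq hσ⟩, fun τ hτ => hτ.acyclic⟩
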